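/- **Setting.** Let $w$ be a nonnegative weight function on $[1,\infty)$ with finite moments of all orders and $\int_1^\infty w>0$, and put $c_w=\left(\int_1^\infty w(x)\,dx\right)^{-1}$. For $n\ge 1$ let $x_{1,n},\dots,x_{n,n}$ be the zeros of the orthogonal polynomial of degree $n$ with respect to $w$, and $\lambda_{1,n},\dots,\lambda_{n,n}$ the weights of the Gauss quadrature rule $$c_w\int_1^\infty f(x)w(x)\,dx=\sum_{k=1}^n\lambda_{k,n}f(x_{k,n})\qquad(\deg f\le 2n-1).$$ (These exist, the zeros are distinct and lie in $(1,\infty)$, and $\lambda_{k,n}>0$.) Define $\theta_{k,n}\ge 0$ by $x_{k,n}=\cosh\theta_{k,n}$ and $$s_{j,k}=\cosh\tfrac{\theta_{j,n}-\theta_{k,n}}2,\qquad t_{j,k}=\cosh\tfrac{\theta_{j,n}+\theta_{k,n}}2 .$$ For $\gamma=\pm\frac12$ let $W_\gamma(u,v)=w(x)w(y)\,|u^2-4v|^\gamma$ where $u=x+y$, $v=xy$, and let $$\mathcal W_\gamma(x,y)=W_\gamma(2xy,\,x^2+y^2-1)\,|x^2-y^2|,\qquad (x,y)\in G=(-\infty,-1]^2\cup[1,\infty)^2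 .$$ Let $\Pi_m^2$ be the space of real polynomials in two variables of total degree at most $m$. A cubature rule $\sum_{i=1}^N a_i f(z_i)$, with distinct nodes $z_i\in\mathbb R^2$ and real coefficients $a_i\ne0$, has degree $m$ for a given integral if it equals the integral for all $f\in\Pi_m^2$ but not for all $f\in\Pi_{m+1}^2$. It is minimal if no cubature rule that is exact on $\Pi_m^2$ has fewer nodes. **Theorem.** All polynomials are integrable on $G$ against $\mathcal W_{\pm\frac12}$, and the following hold. (i) For every $n\ge1$, $$c_w^2\int_G f\,\mathcal W_{-\frac12}\,dx\,dy=\frac14\sum_{k=1}^n\mathop{{\sum}'}_{j=1}^{k}\lambda_{j,n}\lambda_{k,n}\big[f(s_{j,k},t_{j,k})+f(t_{j,k},s_{j,k})+f(-s_{j,k},-t_{j,k})+f(-t_{j,k},-s_{j,k})\big]$$ for all $f\in\Pi_{4n-1}^2$, where $\sum'$ means that the term with $j=k$ is halved. This is a minimal cubature rule of degree $4n-1$. It has exactly $\dim\Pi_{2n-1}^2+n$ nodes. (ii) For every $n\ge2$, $$c_w^2\int_G f\,\mathcal W_{\frac12}\,dx\,dy=\frac14\sum_{k=2}^n\sum_{j=1}^{k-1}\lambda_{j,k}\big[f(s_{j,k},t_{j,k})+f(t_{j,k},s_{j,k})+f(-s_{j,k},-t_{j,k})+f(-t_{j,k},-s_{j,k})\big]$$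 for all $f\in\Pi_{4n-5}^2$, where $\lambda_{j,k}=\lambda_{j,n}\lambda_{k,n}(\cosh\theta_{j,n}-\cosh\theta_{k,n})^2$. This is a minimal cubature rule of degree $4n-5$. It has exactly $\dim\Pi_{2n-3}^2+n-1$ nodes. Both rules attain Möller's number of nodes $\dim\Pi_{m-1}^2+\lfloor m/2\rfloor$ for degree $2m-1$, with $m=2n$ in (i) and $m=2n-2$ in (ii). -/

import Mathlib

open MeasureTheory

noncomputable section

namespace MinCub

/-! ### One variable: weight, orthogonal polynomial, Gauss quadrature -/

/-- A nonnegative weight function on `[1, ∞)`: it has finite moments of every order and it is not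
almost everywhere zero. Only the values on `[1, ∞)` matter. -/
structure IsWeight (w : ℝ → ℝ) : Prop where
  nonneg : ∀ x, 1 ≤ x → 0 ≤ w x
  moments : ∀ k : ℕ, IntegrableOn (fun x => x ^ k * w x) (Set.Ici 1)
  pos : 0 < ∫ x in Set.Ici (1 : ℝ), w x

/-- The normalization constant `c_w`, with `c_w * ∫_1^∞ w = 1`. -/
def normConst (w : ℝ → ℝ) : ℝ := (∫ x in Set.Ici (1 : ℝ), w x)⁻¹

/-- `p` is an orthogonal polynomial of degree `n` with respect to `w` on `[1, ∞)`. -/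
def IsOrthPoly (w : ℝ → ℝ) (n : ℕ) (p : Polynomial ℝ) : Prop :=
  p.degree = n ∧
    ∀ q : Polynomial ℝ, q.degree < n → ∫ x in Set.Ici (1 : ℝ), p.eval x * q.eval x * w x = 0

/-- `x` lists, without repetition, the zeros of the orthogonal polynomial of degree `n`, and `lam`
lists the corresponding weights of the Gauss quadrature rule, which is exact in degree `2n - 1`. -/
structure IsGaussRule (w : ℝ → ℝ) (n : ℕ) (x lam : Fin n → ℝ) : Prop where
  injective : Function.Injective x
  zeros : ∃ p, IsOrthPoly w n p ∧ ∀ t, p.IsRoot t ↔ ∃ k, x k = t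
  exact : ∀ f : Polynomial ℝ, f.natDegree < 2 * n →
    normConst w * ∫ t in Set.Ici (1 : ℝ), f.eval t * w t = ∑ k, lam k * f.eval (x k)

/-! ### Two variables: cubature rules -/

/-- A real polynomial in two variables as a function on the plane. -/
def evalAt (f : MvPolynomial (Fin 2) ℝ) (z : ℝ × ℝ) : ℝ := MvPolynomial.eval ![z.1, z.2] f

/-- The dimension of the space of polynomials in two variables of total degree at most `m`. -/
def dimPi (m : ℕ) : ℕ := Module.finrank ℝ (MvPolynomial.restrictTotalDegree (Fin 2) ℝ m)

/-- Möller's number `dim Π_{m-1} + ⌊m/2⌋` for rules of degree `2m - 1`, where `m ≥ 1`. -/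
def mollerNumber (m : ℕ) : ℕ := dimPi (m - 1) + m / 2

/-- The sum `∑ a_i f(z_i)`. A cubature rule is represented by a finitely supported function
`R : ℝ × ℝ →₀ ℝ`: its support is the set of nodes and its values there are the (nonzero)
coefficients. -/
def cubSum (R : ℝ × ℝ →₀ ℝ) (f : MvPolynomial (Fin 2) ℝ) : ℝ := R.sum fun z a => a * evalAt f z

/-- The rule `R` is exact for the integral `∫_G f W` for every polynomial of degree at most `m`. -/
def IsExact (G : Set (ℝ × ℝ)) (W : ℝ × ℝ → ℝ) (m : ℕ) (R : ℝ × ℝ →₀ ℝ) : Prop :=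
  ∀ f : MvPolynomial (Fin 2) ℝ, f.totalDegree ≤ m → ∫ z in G, evalAt f z * W z = cubSum R f

/-- `R` has degree (of precision) `m`: it is exact in degree `m` but not in degree `m + 1`. -/
def HasPrecision (G : Set (ℝ × ℝ)) (W : ℝ × ℝ → ℝ) (m : ℕ) (R : ℝ × ℝ →₀ ℝ) : Prop :=
  IsExact G W m R ∧ ¬ IsExact G W (m + 1) R

/-- `R` is a minimal cubature rule of degree `m`: no rule that is exact in degree `m` (so in
particular no rule of precision `m`) has fewer nodes, wherever in the plane its nodes lie. -/
def IsMinimalCubature (G : Set (ℝ × ℝ)) (W : ℝ × ℝ → ℝ) (m : ℕ) (R : ℝ × ℝ →₀ ℝ) : Prop :=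
  HasPrecision G W m R ∧
    ∀ R' : ℝ × ℝ →₀ ℝ, IsExact G W m R' → R.support.card ≤ R'.support.card

/-! ### The domain and the weights -/

/-- `G = (-∞, -1]² ∪ [1, ∞)²`. -/
def domG : Set (ℝ × ℝ) :=
  Set.Iic (-1 : ℝ) ×ˢ Set.Iic (-1 : ℝ) ∪ Set.Ici (1 : ℝ) ×ˢ Set.Ici (1 : ℝ)

/-- `W_γ(u, v) = w(x) w(y) |u² - 4v|^γ`, where `u = x + y`, `v = x y`, that is, `x` and `y` are
`(u ∓ √(u² - 4v)) / 2`. -/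
def weightW (w : ℝ → ℝ) (γ u v : ℝ) : ℝ :=
  w ((u - √(u ^ 2 - 4 * v)) / 2) * w ((u + √(u ^ 2 - 4 * v)) / 2) * |u ^ 2 - 4 * v| ^ γ

theorem weightW_add_mul (w : ℝ → ℝ) (γ x y : ℝ) :
    weightW w γ (x + y) (x * y) = w x * w y * |(x + y) ^ 2 - 4 * (x * y)| ^ γ := by
  have h : √((x + y) ^ 2 - 4 * (x * y)) = |x - y| := by
    rw [← Real.sqrt_sq_eq_abs]; congr 1; ring
  unfold weightW
  rw [h]
  rcases abs_cases (x - y) with ⟨h1, _⟩ | ⟨h1, _⟩ <;> rw [h1]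
  · rw [show (x + y - (x - y)) / 2 = y by ring, show (x + y + (x - y)) / 2 = x by ring,
      mul_comm (w y)]
  · rw [show (x + y - -(x - y)) / 2 = x by ring, show (x + y + -(x - y)) / 2 = y by ring]

/-- The centrally symmetric weight `𝒲_γ(x, y) = W_γ(2xy, x² + y² - 1) |x² - y²|`. -/
def calW (w : ℝ → ℝ) (γ : ℝ) (z : ℝ × ℝ) : ℝ :=
  weightW w γ (2 * z.1 * z.2) (z.1 ^ 2 + z.2 ^ 2 - 1) * |z.1 ^ 2 - z.2 ^ 2|

/-! ### The two rules -/

section rules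

variable {n : ℕ} (x lam : Fin n → ℝ)

/-- `θ_k ≥ 0` with `cosh θ_k = x_k`. -/
def theta (k : Fin n) : ℝ := Real.arcosh (x k)

def sNode (j k : Fin n) : ℝ := Real.cosh ((theta x j - theta x k) / 2)

def tNode (j k : Fin n) : ℝ := Real.cosh ((theta x j + theta x k) / 2)

/-- The formal sum of the four points `(s, t), (t, s), (-s, -t), (-t, -s)`. -/
def fourPoints (s t : ℝ) : ℝ × ℝ →₀ ℝ :=
  Finsupp.single (s, t) 1 + Finsupp.single (t, s) 1 + Finsupp.single (-s, -t) 1 +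
    Finsupp.single (-t, -s) 1

/-- The sum of the values of `f` at these four points. -/
def fourSum (f : MvPolynomial (Fin 2) ℝ) (s t : ℝ) : ℝ :=
  evalAt f (s, t) + evalAt f (t, s) + evalAt f (-s, -t) + evalAt f (-t, -s)

/-- The coefficient `λ_j λ_k (cosh θ_j - cosh θ_k)²`. -/
def lamPair (j k : Fin n) : ℝ :=
  lam j * lam k * (Real.cosh (theta x j) - Real.cosh (theta x k)) ^ 2

/-- The cubature rule for `γ = -1/2`; the terms with `j = k` are halved. -/
def ruleMinus : ℝ × ℝ →₀ ℝ :=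
  (1 / 4 : ℝ) • ∑ k, ∑ j ∈ Finset.Iic k,
    ((if j = k then 1 / 2 else 1) * (lam j * lam k)) • fourPoints (sNode x j k) (tNode x j k)

/-- The cubature rule for `γ = 1/2`. -/
def rulePlus : ℝ × ℝ →₀ ℝ :=
  (1 / 4 : ℝ) • ∑ k, ∑ j ∈ Finset.Iio k,
    lamPair x lam j k • fourPoints (sNode x j k) (tNode x j k)

end rules

end MinCub

end

open MeasureTheory

noncomputable section

namespace MinCub

/-! ### Möller's lower bound for centrally symmetric functionals -/

section moller

open MvPolynomial

/-! The map sending (cosh a, cosh b) to (X, Y) = (cosh (a + b), cosh (a - b)) satisfies 2st = X + Y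
and s² + t² = 1 + XY at (s, t) = (cosh a, cosh b). It is a bijection of the wedge 1 < t < s onto
itself, and its Jacobian turns the weight with exponent -1/2 into w(X)w(Y)/4 (`calW_neg_half`). The
wedge and its images under swap and negation fill `domG` up to a null set, so only the four-point
symmetrization of f matters. If f has degree at most 2d + 1, that symmetrization is a polynomial of
degree at most d in each of X and Y (`exists_biPoly_fourSum`). For d = 2n - 1 the product Gauss rule
integrates it exactly, and pulling the grid back gives the rule for -1/2
(`setIntegral_domG_eq_sum`).

The weight for 1/2 is the weight for -1/2 times 4(s² - 1)(t² - 1) = (X - Y)². This factor costs four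
degrees, multiplies the coefficients by (X - Y)², and kills the diagonal terms.

Minimality is Möller's lower bound for positive definite, centrally symmetric functionals
(`two_mul_dimPi_add_le_card`). The shape of each rule allows at most four nodes per pair j, k, and
this crude upper bound equals the lower bound. Hence the node count is exact without any check that
nodes are distinct or coefficients nonzero. Exactness in one more degree would need more nodes than
there are (`dimPi_le_card`). -/

theorem two_mul_dimPi (m : ℕ) : 2 * dimPi m = (m + 1) * (m + 2) := by
  -- An exponent pair is recorded by its degree and its first entry.
  have e : {s : Fin 2 →₀ ℕ | (s.sum fun _ e => e) ≤ m} ≃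
      ((Finset.range (m + 1)).sigma fun k => Finset.range (k + 1) : Finset (Σ _ : ℕ, ℕ)) :=
    { toFun := fun s => ⟨⟨s.1 0 + s.1 1, s.1 0⟩, by
        have h : (s.1.sum fun _ e => e) ≤ m := s.2
        rw [Finsupp.sum_fintype _ _ (fun _ => rfl), Fin.sum_univ_two] at h
        simp only [Finset.mem_sigma, Finset.mem_range]; omega⟩
      invFun := fun k => ⟨Finsupp.equivFunOnFinite.symm ![k.1.2, k.1.1 - k.1.2], by
        have h := k.2
        simp only [Finset.mem_sigma, Finset.mem_range] at h
        show (Finsupp.sum _ fun _ e => e) ≤ m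
        rw [Finsupp.sum_fintype _ _ (fun _ => rfl), Fin.sum_univ_two]
        simp; omega⟩
      left_inv := fun s => by
        apply Subtype.ext; ext i; fin_cases i <;> simp
      right_inv := fun k => by
        have h := k.2
        simp only [Finset.mem_sigma, Finset.mem_range] at h
        apply Subtype.ext
        rcases k with ⟨⟨a, b⟩, hk⟩
        simp at h ⊢; omega }
  have h : dimPi m = ∑ k ∈ Finset.range (m + 1), (k + 1) := by
    rw [dimPi, restrictTotalDegree, Module.finrank_eq_nat_card_basis (basisRestrictSupport ℝ _), Nat.card_congr e,
      Nat.card_eq_fintype_card, Fintype.card_coe, Finset.card_sigma]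
    simp
  rw [h]
  clear h e
  induction m with
  | zero => simp
  | succ m ih => rw [Finset.sum_range_succ, mul_add, ih]; ring

/-- The substitution `(x, y) ↦ (-x, -y)`. -/
def negVars : MvPolynomial (Fin 2) ℝ →ₐ[ℝ] MvPolynomial (Fin 2) ℝ := aeval fun i => -X i

theorem negVars_X (i : Fin 2) : negVars (X i) = -X i := by simp [negVars]

theorem negVars_monomial (s : Fin 2 →₀ ℕ) (a : ℝ) :
    negVars (monomial s a) = monomial s ((-1) ^ s.degree * a) := by
  have h : (-1 : MvPolynomial (Fin 2) ℝ) = C (-1) := by simp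
  rw [negVars, aeval_monomial, monomial_eq, Finsupp.prod_fintype _ _ (fun _ => pow_zero _),
    Finsupp.prod_fintype _ _ (fun _ => pow_zero _), Finsupp.degree_eq_sum]
  simp only [neg_pow (X _ : MvPolynomial (Fin 2) ℝ), Finset.prod_mul_distrib,
    Finset.prod_pow_eq_pow_sum, algebraMap_eq, h, C_mul, C_pow]
  ring

theorem coeff_negVars (f : MvPolynomial (Fin 2) ℝ) (s : Fin 2 →₀ ℕ) :
    coeff s (negVars f) = (-1) ^ s.degree * coeff s f := by
  induction f using MvPolynomial.induction_on' with
  | monomial t a =>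
    rw [negVars_monomial, coeff_monomial, coeff_monomial]
    split_ifs with h
    · rw [h]
    · simp
  | add p q hp hq => rw [map_add, coeff_add, coeff_add, hp, hq, mul_add]

theorem negVars_of_isHomogeneous {f : MvPolynomial (Fin 2) ℝ} {k : ℕ} (hf : f.IsHomogeneous k) :
    negVars f = (-1) ^ k * f := by
  have h : (-1 : MvPolynomial (Fin 2) ℝ) ^ k = C ((-1) ^ k) := by simp
  ext s
  rw [coeff_negVars, h, coeff_C_mul]
  by_cases hs : s.degree = k
  · rw [hs]
  · rw [hf.coeff_eq_zero hs]; simp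

theorem totalDegree_le_iff_coeff {f : MvPolynomial (Fin 2) ℝ} {k : ℕ} :
    f.totalDegree ≤ k ↔ ∀ s : Fin 2 →₀ ℕ, k < s.degree → coeff s f = 0 := by
  rw [totalDegree, Finset.sup_le_iff]
  constructor
  · intro h s hs
    by_contra hne
    have := h s (mem_support_iff.2 hne)
    rw [Finsupp.degree_eq_sum] at hs
    rw [Finsupp.sum_fintype _ _ (fun _ => rfl)] at this
    omega
  · intro h s hs
    by_contra hne
    refine mem_support_iff.1 hs (h s ?_)
    rw [Finsupp.degree_eq_sum]
    rw [Finsupp.sum_fintype _ _ (fun _ => rfl)] at hne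
    omega

/-- In even degree `k + 1`, the odd part of a polynomial has degree at most `k`. -/
theorem totalDegree_sub_negVars_le {f : MvPolynomial (Fin 2) ℝ} {k : ℕ} (hk : Even (k + 1))
    (hf : f.totalDegree ≤ k + 1) : (f - negVars f).totalDegree ≤ k := by
  rw [totalDegree_le_iff_coeff] at hf ⊢
  intro s hs
  rw [coeff_sub, coeff_negVars]
  rcases (Nat.succ_le_of_lt hs).eq_or_lt with h | h
  · rw [← h, hk.neg_one_pow]; ring
  · rw [hf s h]; ring

theorem negVars_negVars (f : MvPolynomial (Fin 2) ℝ) : negVars (negVars f) = f := by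
  ext s
  rw [coeff_negVars, coeff_negVars, ← mul_assoc, ← mul_pow]; simp

theorem evalAt_negVars (f : MvPolynomial (Fin 2) ℝ) (z : ℝ × ℝ) :
    evalAt (negVars f) z = evalAt f (-z.1, -z.2) := by
  unfold evalAt
  induction f using MvPolynomial.induction_on with
  | C a => simp [negVars]
  | add p q hp hq => simp [hp, hq]
  | mul_X p i hp => rw [map_mul, map_mul, map_mul, hp, negVars_X]; fin_cases i <;> simp

/-- A positive definite, centrally symmetric linear functional on polynomials. -/
structure IsSymmPosDef (L : MvPolynomial (Fin 2) ℝ →ₗ[ℝ] ℝ) : Prop where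
  pos : ∀ f, f ≠ 0 → 0 < L (f * f)
  symm : ∀ f, L (negVars f) = L f

/-- Evaluation at the nodes of a rule. -/
def evalNodes (R : ℝ × ℝ →₀ ℝ) : MvPolynomial (Fin 2) ℝ →ₗ[ℝ] (R.support → ℝ) where
  toFun f z := evalAt f z
  map_add' f g := by ext z; simp [evalAt]
  map_smul' a f := by ext z; simp [evalAt]

theorem cubSum_mul_eq_zero {R : ℝ × ℝ →₀ ℝ} {f : MvPolynomial (Fin 2) ℝ} (hf : evalNodes R f = 0)
    (g : MvPolynomial (Fin 2) ℝ) : cubSum R (f * g) = 0 := by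
  refine Finset.sum_eq_zero fun z hz => ?_
  have h : evalAt f z = 0 := congrFun hf ⟨z, hz⟩
  have h' : evalAt (f * g) z = evalAt f z * evalAt g z := by simp [evalAt]
  simp [h', h]

/-- If f of degree at most m vanished at all nodes, exactness on f² would give L(f²) = 0. So
evaluation at the nodes is injective on that space. -/
theorem dimPi_le_card {L : MvPolynomial (Fin 2) ℝ →ₗ[ℝ] ℝ} (hL : IsSymmPosDef L) {m : ℕ}
    {R : ℝ × ℝ →₀ ℝ} (hR : ∀ f, f.totalDegree ≤ 2 * m → L f = cubSum R f) :
    dimPi m ≤ R.support.card := by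
  have hinj : Function.Injective
      ((evalNodes R).comp (restrictTotalDegree (Fin 2) ℝ m).subtype) := by
    rw [← LinearMap.ker_eq_bot, LinearMap.ker_eq_bot']
    rintro ⟨f, hf⟩ h
    rw [mem_restrictTotalDegree] at hf
    replace h : evalNodes R f = 0 := h
    by_contra hne
    have h0 := hL.pos f fun h => hne (Subtype.ext h)
    rw [hR _ ((totalDegree_mul _ _).trans (by omega)), cubSum_mul_eq_zero h] at h0
    exact h0.false
  have := LinearMap.finrank_le_finrank_of_injective hinj
  rwa [Module.finrank_fintype_fun_eq_card, Fintype.card_coe] at this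

/-- The binary form of degree `k` with given coefficients. -/
def binaryForm (k : ℕ) : (Fin (k + 1) → ℝ) →ₗ[ℝ] MvPolynomial (Fin 2) ℝ :=
  ∑ i : Fin (k + 1), (monomial (Finsupp.single 0 (i : ℕ) + Finsupp.single 1 (k - i))).comp
    (LinearMap.proj i)

theorem isHomogeneous_binaryForm (k : ℕ) (a : Fin (k + 1) → ℝ) :
    (binaryForm k a).IsHomogeneous k := by
  rw [binaryForm, LinearMap.sum_apply]
  refine IsHomogeneous.sum _ _ _ fun i _ => isHomogeneous_monomial _ ?_
  have := i.2
  simp [Finsupp.degree_eq_sum]; omega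

theorem binaryForm_injective (k : ℕ) : Function.Injective (binaryForm k) := by
  intro a b h
  ext i
  have key : ∀ c, coeff (Finsupp.single 0 (i : ℕ) + Finsupp.single 1 (k - i)) (binaryForm k c)
      = c i := by
    intro c
    rw [binaryForm, LinearMap.sum_apply, coeff_sum, Finset.sum_eq_single i]
    · simp
    · intro j _ hj
      simp only [LinearMap.comp_apply, coeff_monomial]
      rw [if_neg]
      intro h
      apply hj
      have := DFunLike.congr_fun h 0
      simp at this
      exact Fin.ext this
    · simp
  rw [← key a, h, key b]

/-- Write v* for v after negating the variables. As k + 1 is even, v - v* loses its top degree and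
is a legitimate test polynomial. Orthogonality of v, and by symmetry of v*, to it gives L((v - v*)²)
= 0. -/
theorem even_of_orthogonal {L : MvPolynomial (Fin 2) ℝ →ₗ[ℝ] ℝ} (hL : IsSymmPosDef L) {k : ℕ}
    (hk : Even (k + 1)) {v : MvPolynomial (Fin 2) ℝ} (hv : v.totalDegree ≤ k + 1)
    (h : ∀ q : MvPolynomial (Fin 2) ℝ, q.totalDegree ≤ k → L (v * q) = 0) : negVars v = v := by
  by_contra hne
  have h0 := hL.pos (v - negVars v) (fun h => hne (sub_eq_zero.1 h).symm)
  have hq := h _ (totalDegree_sub_negVars_le hk hv)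
  have hq' : L (negVars v * (v - negVars v)) = 0 := by
    rw [← hL.symm, map_mul, negVars_negVars, map_sub, negVars_negVars, ← neg_sub v, mul_neg,
      map_neg, hq, neg_zero]
  rw [sub_mul, map_sub, hq, hq'] at h0
  simp at h0

/-- An odd polynomial `c` such that `x c` and `y c` are orthogonal to all polynomials of degree
less than that of `c` vanishes. -/
theorem eq_zero_of_odd_of_orthogonal {L : MvPolynomial (Fin 2) ℝ →ₗ[ℝ] ℝ} (hL : IsSymmPosDef L)
    {k : ℕ} {c : MvPolynomial (Fin 2) ℝ} (hc : negVars c = -c) (hdeg : c.totalDegree ≤ k)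
    (h : ∀ (i : Fin 2) (q : MvPolynomial (Fin 2) ℝ), q.totalDegree ≤ k → L (X i * c * q) = 0) :
    c = 0 := by
  by_contra hne
  have h0 := hL.pos c hne
  rw [totalDegree_le_iff_coeff] at hdeg
  -- L(c²) vanishes monomial by monomial: parity handles the constant monomial, and every other one
  -- has a variable to hand over to c.
  suffices ∀ s ∈ c.support, L (c * monomial s (coeff s c)) = 0 by
    have e : L (c * c) = ∑ s ∈ c.support, L (c * monomial s (coeff s c)) := by
      rw [← map_sum, ← Finset.mul_sum, ← MvPolynomial.as_sum]
    rw [e, Finset.sum_eq_zero this] at h0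
    exact h0.false
  intro s hs
  have hsk : s.degree ≤ k := by
    by_contra hlt
    exact mem_support_iff.1 hs (hdeg s (by omega))
  by_cases hs0 : s = 0
  · have h1 : L (c * monomial s (coeff s c)) = -L (c * monomial s (coeff s c)) := by
      conv_lhs => rw [← hL.symm, map_mul, hc, negVars_monomial, hs0]
      rw [hs0, ← map_neg]
      simp
    linarith
  · obtain ⟨i, hi⟩ : ∃ i, s i ≠ 0 := by
      by_contra hall
      push Not at hall
      exact hs0 (Finsupp.ext hall)
    have hsplit : s = Finsupp.single i 1 + (s - Finsupp.single i 1) := by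
      rw [add_tsub_cancel_of_le]
      rw [Finsupp.single_le_iff]; omega
    have e : monomial s (coeff s c) = X i * monomial (s - Finsupp.single i 1) (coeff s c) := by
      conv_lhs => rw [hsplit]
      rw [X, monomial_mul, one_mul, ← hsplit]
    have hd := congrArg Finsupp.degree hsplit
    rw [map_add, Finsupp.degree_single] at hd
    rw [e, ← mul_assoc, mul_comm c]
    refine h i _ (totalDegree_le_iff_coeff.2 fun t ht => ?_)
    rw [coeff_monomial, if_neg]
    rintro rfl
    omega

/-- Möller's lower bound in degree `2 (k + 1) - 1`, for `k` odd. -/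
theorem two_mul_dimPi_add_le_card {L : MvPolynomial (Fin 2) ℝ →ₗ[ℝ] ℝ} (hL : IsSymmPosDef L)
    {k : ℕ} (hk : Even (k + 1)) {R : ℝ × ℝ →₀ ℝ}
    (hR : ∀ f, f.totalDegree ≤ 2 * k + 1 → L f = cubSum R f) :
    2 * dimPi k + (k + 1) ≤ 2 * R.support.card := by
  have hk' : Odd k := by rwa [Nat.even_add_one, Nat.not_even_iff_odd] at hk
  let P := restrictTotalDegree (Fin 2) ℝ k
  let mulX (i : Fin 2) : (Fin (k + 1) → ℝ) →ₗ[ℝ] MvPolynomial (Fin 2) ℝ :=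
    (LinearMap.mulLeft ℝ (X i)).comp (binaryForm k)
  -- Φ sends g, h and a form p of degree k to (xp - g, yp - h). Injectivity of Φ followed by
  -- evaluation at the nodes yields the bound by counting dimensions.
  let Φ : (P × P) × (Fin (k + 1) → ℝ) →ₗ[ℝ] MvPolynomial (Fin 2) ℝ × MvPolynomial (Fin 2) ℝ :=
    ((mulX 0).prod (mulX 1)).comp (LinearMap.snd ℝ _ _) -
      (P.subtype.prodMap P.subtype).comp (LinearMap.fst ℝ _ _)
  have hinj : Function.Injective (((evalNodes R).prodMap (evalNodes R)).comp Φ) := by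
    rw [← LinearMap.ker_eq_bot, LinearMap.ker_eq_bot']
    rintro ⟨⟨⟨g, hg⟩, ⟨h, hh⟩⟩, a⟩ hz
    rw [mem_restrictTotalDegree] at hg hh
    obtain ⟨h1, h2⟩ := Prod.mk.inj hz
    replace h1 : evalNodes R (X 0 * binaryForm k a - g) = 0 := h1
    replace h2 : evalNodes R (X 1 * binaryForm k a - h) = 0 := h2
    have hp := isHomogeneous_binaryForm k a
    have hpodd : negVars (binaryForm k a) = -binaryForm k a := by
      rw [negVars_of_isHomogeneous hp, hk'.neg_one_pow, neg_one_mul]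
    have hp0 : binaryForm k a = 0 → a = 0 := fun h =>
      binaryForm_injective k (by rw [h, map_zero])
    generalize binaryForm k a = p at h1 h2 hp hpodd hp0
    have orth : ∀ v : MvPolynomial (Fin 2) ℝ, v.totalDegree ≤ k + 1 → evalNodes R v = 0 →
        ∀ q : MvPolynomial (Fin 2) ℝ, q.totalDegree ≤ k → L (v * q) = 0 := by
      intro v hv hv0 q hq
      rw [hR _ ((totalDegree_mul _ _).trans (by omega)), cubSum_mul_eq_zero hv0]
    have degX : ∀ (i : Fin 2) (q : MvPolynomial (Fin 2) ℝ), q.totalDegree ≤ k →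
        (X i * q).totalDegree ≤ k + 1 := fun i q hq =>
      (totalDegree_mul _ _).trans (by rw [totalDegree_X]; omega)
    have hpdeg := hp.totalDegree_le
    have d1 : (X 0 * p - g).totalDegree ≤ k + 1 :=
      (totalDegree_sub _ _).trans (max_le (degX 0 p hpdeg) (by omega))
    have d2 : (X 1 * p - h).totalDegree ≤ k + 1 :=
      (totalDegree_sub _ _).trans (max_le (degX 1 p hpdeg) (by omega))
    have o1 := orth _ d1 h1
    have o2 := orth _ d2 h2
    -- Since k is odd, xp and yp are even, so g and h are even too.
    have e1 := even_of_orthogonal hL hk d1 o1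
    have e2 := even_of_orthogonal hL hk d2 o2
    rw [map_sub, map_mul, negVars_X, hpodd, neg_mul_neg, sub_right_inj] at e1 e2
    -- This polynomial is odd, because g and h are even. It also lies in the ideal of the nodes and
    -- has degree at most k + 1, so it is orthogonal to degree k and therefore even.
    have hsyz : X 0 * h - X 1 * g = 0 := by
      have hd : (X 0 * h - X 1 * g).totalDegree ≤ k + 1 :=
        (totalDegree_sub _ _).trans (max_le (degX 0 h hh) (degX 1 g hg))
      have hv : evalNodes R (X 0 * h - X 1 * g) = 0 := by
        have h' : ∀ (u v : MvPolynomial (Fin 2) ℝ), evalNodes R v = 0 →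
            evalNodes R (u * v) = 0 := by
          intro u v hv
          ext z
          have : evalAt v z = 0 := congrFun hv z
          have h' : evalAt (u * v) z = evalAt u z * evalAt v z := by simp [evalAt]
          show evalAt (u * v) z = 0
          simp [h', this]
        have : X 0 * h - X 1 * g = X 1 * (X 0 * p - g) - X 0 * (X 1 * p - h) := by ring
        rw [this, map_sub, h' _ _ h1, h' _ _ h2, sub_zero]
      have he := even_of_orthogonal hL hk hd (orth _ hd hv)
      rw [map_sub, map_mul, map_mul, negVars_X, negVars_X, e1, e2] at he
      have : (2 : MvPolynomial (Fin 2) ℝ) * (X 0 * h - X 1 * g) = 0 := by linear_combination -he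
      simpa using this
    obtain ⟨c, hc⟩ : X 0 ∣ g := by
      have hdvd : (X 0 : MvPolynomial (Fin 2) ℝ) ∣ X 1 * g := ⟨h, (sub_eq_zero.1 hsyz).symm⟩
      refine (X_prime.dvd_or_dvd hdvd).resolve_left fun h => ?_
      rw [X_dvd_X] at h
      simp at h
    have hX : ∀ i : Fin 2, (X i : MvPolynomial (Fin 2) ℝ) ≠ 0 := fun i => X_ne_zero i
    have hc' : h = X 1 * c := by
      rw [hc] at hsyz
      exact mul_left_cancel₀ (hX 0) (by linear_combination hsyz)
    have hcdeg : c = 0 ∨ c.totalDegree + 1 ≤ k := by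
      rcases eq_or_ne c 0 with h | h
      · exact .inl h
      · right
        rw [hc, totalDegree_mul_of_isDomain (hX 0) h, totalDegree_X] at hg
        omega
    have hcodd : negVars c = -c := by
      rw [hc, map_mul, negVars_X] at e1
      exact mul_left_cancel₀ (hX 0) (by linear_combination -e1)
    -- Here x(p - c) = xp - g and y(p - c) = yp - h, both orthogonal to degree k, and p - c is odd.
    -- Afterwards p = c is impossible unless both vanish: p is homogeneous of degree k, while a
    -- nonzero c has smaller degree.
    have hpc : p - c = 0 := by
      refine eq_zero_of_odd_of_orthogonal hL (k := k) ?_ ?_ ?_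
      · rw [map_sub, hpodd, hcodd]; ring
      · refine (totalDegree_sub _ _).trans (max_le hpdeg ?_)
        rcases hcdeg with rfl | h
        · simp
        · omega
      · intro i
        fin_cases i
        · simpa [mul_sub, ← hc] using o1
        · simpa [mul_sub, ← hc'] using o2
    have hp00 : p = 0 := by
      rw [sub_eq_zero] at hpc
      by_contra hne
      have := hp.totalDegree hne
      rw [← hpc] at hcdeg
      rcases hcdeg with h | h
      · exact hne h
      · omega
    have hc0 : c = 0 := by rw [hp00, zero_sub, neg_eq_zero] at hpc; exact hpc
    have hg0 : g = 0 := by rw [hc, hc0, mul_zero]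
    have hh0 : h = 0 := by rw [hc', hc0, mul_zero]
    subst hg0 hh0
    rw [hp0 hp00]
    rfl
  have := LinearMap.finrank_le_finrank_of_injective hinj
  simp only [Module.finrank_prod, Module.finrank_fintype_fun_eq_card, Fintype.card_coe,
    Fintype.card_fin] at this
  change dimPi k + dimPi k + (k + 1) ≤ _ at this
  omega

end moller

/-! ### Gauss quadrature on `[1, ∞)` -/

section gauss

open Polynomial

variable {w : ℝ → ℝ}

theorem IsWeight.integrableOn_eval (hw : IsWeight w) (f : ℝ[X]) :
    IntegrableOn (fun t => f.eval t * w t) (Set.Ici 1) := by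
  have h : (fun t => f.eval t * w t) =
      fun t => ∑ i ∈ Finset.range (f.natDegree + 1), f.coeff i * (t ^ i * w t) := by
    ext t
    rw [eval_eq_sum_range, Finset.sum_mul]
    exact Finset.sum_congr rfl fun i _ => by ring
  rw [h]
  exact integrable_finsetSum _ fun i _ => (hw.moments i).const_mul _

/-- The functional `f ↦ c_w ∫ f w`. -/
def weightFunctional (hw : IsWeight w) : ℝ[X] →ₗ[ℝ] ℝ where
  toFun f := normConst w * ∫ t in Set.Ici (1 : ℝ), f.eval t * w t
  map_add' f g := by
    rw [← mul_add, ← integral_add (hw.integrableOn_eval f) (hw.integrableOn_eval g)]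
    simp only [eval_add, add_mul]
  map_smul' a f := by
    simp only [eval_smul, smul_eq_mul, RingHom.id_apply, mul_assoc, integral_const_mul]
    ring

theorem weightFunctional_apply (hw : IsWeight w) (f : ℝ[X]) :
    weightFunctional hw f = normConst w * ∫ t in Set.Ici (1 : ℝ), f.eval t * w t := rfl

theorem IsWeight.normConst_pos (hw : IsWeight w) : 0 < normConst w := inv_pos.2 hw.pos

theorem weightFunctional_pos (hw : IsWeight w) {f : ℝ[X]} (h0 : f ≠ 0)
    (hf : ∀ t, 1 ≤ t → 0 ≤ f.eval t) : 0 < weightFunctional hw f := by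
  refine mul_pos hw.normConst_pos ?_
  have hnn : ∀ t ∈ Set.Ici (1 : ℝ), 0 ≤ f.eval t * w t := fun t ht =>
    mul_nonneg (hf t ht) (hw.nonneg t ht)
  refine (setIntegral_nonneg measurableSet_Ici hnn).lt_of_ne fun h => hw.pos.ne ?_
  rw [eq_comm, setIntegral_eq_zero_iff_of_nonneg_ae
    ((ae_restrict_iff' measurableSet_Ici).2 (ae_of_all _ hnn)) (hw.integrableOn_eval f)] at h
  have hfin : {t : ℝ | f.IsRoot t}.Finite := by
    refine (f.roots.toFinset.finite_toSet).subset fun t ht => ?_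
    simpa [h0] using ht
  have hroot : ∀ᵐ t ∂volume.restrict (Set.Ici (1 : ℝ)), ¬ f.IsRoot t :=
    ae_restrict_of_ae (measure_eq_zero_iff_ae_notMem.1 (hfin.measure_zero volume))
  refine (integral_eq_zero_of_ae ?_).symm
  filter_upwards [h, hroot] with t ht hr
  exact (mul_eq_zero.1 ht).resolve_left hr

theorem isOrthPoly_iff (hw : IsWeight w) {n : ℕ} {p : ℝ[X]} : IsOrthPoly w n p ↔
    p.degree = n ∧ ∀ q : ℝ[X], q.degree < n → weightFunctional hw (p * q) = 0 := by
  simp only [IsOrthPoly, weightFunctional_apply, eval_mul, mul_eq_zero, hw.normConst_pos.ne',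
    false_or]

/-- Orthogonality to the powers below n imposes n linear conditions on a space of dimension n + 1. A
solution of degree less than n would be orthogonal to itself. -/
theorem exists_isOrthPoly (hw : IsWeight w) (n : ℕ) : ∃ p, IsOrthPoly w n p := by
  let T : degreeLT ℝ (n + 1) →ₗ[ℝ] (Fin n → ℝ) := LinearMap.pi fun i =>
    (weightFunctional hw).comp
      ((LinearMap.mulRight ℝ (X ^ (i : ℕ) : ℝ[X])).comp (degreeLT ℝ (n + 1)).subtype)
  have hfin : FiniteDimensional ℝ (degreeLT ℝ (n + 1)) :=
    (degreeLTEquiv ℝ (n + 1)).symm.finiteDimensional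
  have hT : LinearMap.ker T ≠ ⊥ := by
    apply LinearMap.ker_ne_bot_of_finrank_lt
    rw [(degreeLTEquiv ℝ (n + 1)).finrank_eq]
    simp
  obtain ⟨⟨p, hp⟩, hker, hne⟩ := Submodule.exists_mem_ne_zero_of_ne_bot hT
  rw [mem_degreeLT] at hp
  have hp0 : p ≠ 0 := fun h => hne (Subtype.ext h)
  have horth : ∀ q : ℝ[X], q.degree < n → weightFunctional hw (p * q) = 0 := by
    intro q hq
    rcases eq_or_ne q 0 with rfl | hq0
    · simp
    rw [← natDegree_lt_iff_degree_lt hq0] at hq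
    rw [q.as_sum_range' n hq, Finset.mul_sum, map_sum]
    refine Finset.sum_eq_zero fun i hi => ?_
    have h := congrFun hker ⟨i, Finset.mem_range.1 hi⟩
    replace h : weightFunctional hw (p * X ^ i) = 0 := h
    rw [← C_mul_X_pow_eq_monomial, ← smul_eq_C_mul, mul_smul_comm, map_smul, h, smul_zero]
  refine ⟨p, (isOrthPoly_iff hw).2 ⟨?_, horth⟩⟩
  refine le_antisymm ?_ (not_lt.1 fun hlt => ?_)
  · rw [← natDegree_lt_iff_degree_lt hp0] at hp
    exact natDegree_le_iff_degree_le.1 (Nat.lt_succ_iff.1 hp)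
  · have := weightFunctional_pos hw (mul_ne_zero hp0 hp0) fun t _ => by
      rw [eval_mul]; exact mul_self_nonneg _
    rw [horth p hlt] at this
    exact this.false

/-- An orthogonal polynomial has no nonconstant factor that is nonnegative on the real line. -/
theorem IsOrthPoly.natDegree_eq_zero_of_nonneg (hw : IsWeight w) {n : ℕ} {p q h : ℝ[X]}
    (hp : IsOrthPoly w n p) (hq : ∀ t, 0 ≤ q.eval t) (e : p = q * h) : q.natDegree = 0 := by
  rw [isOrthPoly_iff hw] at hp
  have hp0 : p ≠ 0 := by
    rintro rfl
    simp at hp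
  have hq0 : q ≠ 0 := by
    rintro rfl
    exact hp0 (by rw [e, zero_mul])
  have hh0 : h ≠ 0 := by
    rintro rfl
    exact hp0 (by rw [e, mul_zero])
  by_contra hdeg
  have hlt : h.degree < n := by
    have hn := natDegree_eq_of_degree_eq_some hp.1
    rw [e, natDegree_mul hq0 hh0] at hn
    rw [← natDegree_lt_iff_degree_lt hh0]
    omega
  have h1 := hp.2 h hlt
  have h2 := weightFunctional_pos hw (mul_ne_zero hp0 hh0) fun t _ => by
    rw [e, mul_assoc, eval_mul, eval_mul]
    exact mul_nonneg (hq t) (mul_self_nonneg _)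
  exact h2.ne' h1

theorem nonneg_or_nonpos_of_roots_eq_zero {q : ℝ[X]} (h0 : q ≠ 0) (h : q.roots = 0) :
    (∀ t, 0 ≤ q.eval t) ∨ ∀ t, 0 ≤ (-q).eval t := by
  by_contra! hcon
  obtain ⟨⟨a, ha⟩, ⟨b, hb⟩⟩ := hcon
  rw [eval_neg, neg_neg_iff_pos] at hb
  obtain ⟨c, hc⟩ := mem_range_of_exists_le_of_exists_ge q.continuous ⟨a, ha.le⟩ ⟨b, hb.le⟩
  have : c ∈ q.roots := (mem_roots h0).2 hc
  simp [h] at this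

/-- A multiple root would give the nonnegative factor (X - a)². The rootless cofactor of the linear
factors has constant sign, so it is constant and all roots are real. -/
theorem IsOrthPoly.exists_zeros (hw : IsWeight w) {n : ℕ} {p : ℝ[X]} (hp : IsOrthPoly w n p) :
    ∃ x : Fin n → ℝ, Function.Injective x ∧ ∀ t, p.IsRoot t ↔ ∃ k, x k = t := by
  have hp0 : p ≠ 0 := by
    rintro rfl
    simp [IsOrthPoly] at hp
  have hnodup : p.roots.Nodup := by
    rw [Multiset.nodup_iff_count_le_one]
    intro a
    rw [count_roots]
    by_contra! hlt
    obtain ⟨h, e⟩ := (le_rootMultiplicity_iff hp0).1 (Nat.succ_le_of_lt hlt)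
    have := hp.natDegree_eq_zero_of_nonneg hw
      (fun t => by rw [eval_pow]; exact even_two.pow_nonneg _) e
    simp at this
  have hcard : p.roots.card = n := by
    obtain ⟨q, e, hdeg, hroots⟩ := exists_prod_multiset_X_sub_C_mul p
    have hq0 : q ≠ 0 := by
      rintro rfl
      exact hp0 (by rw [← e, mul_zero])
    have hq : q.natDegree = 0 := by
      rcases nonneg_or_nonpos_of_roots_eq_zero hq0 hroots with h | h
      · exact hp.natDegree_eq_zero_of_nonneg hw h (by rw [mul_comm, e])
      · rw [← natDegree_neg]
        exact hp.natDegree_eq_zero_of_nonneg hw h (h := -(p.roots.map fun a => X - C a).prod)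
          (by rw [neg_mul_neg, mul_comm, e])
    rw [natDegree_eq_of_degree_eq_some hp.1] at hdeg
    omega
  have hcard' : p.roots.toFinset.card = n := by
    rw [Multiset.toFinset_card_of_nodup hnodup, hcard]
  let e := (Finset.equivFinOfCardEq hcard').symm
  refine ⟨fun k => e k, fun i j h => e.injective (Subtype.ext h), fun t => ?_⟩
  rw [← mem_roots hp0, ← Multiset.mem_toFinset]
  constructor
  · intro h
    exact ⟨e.symm ⟨t, h⟩, by simp⟩
  · rintro ⟨k, rfl⟩
    exact (e k).2

/-- Division by p splits f: the multiple of p is annihilated by orthogonality, and the remainder is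
integrated through Lagrange interpolation at the zeros. -/
theorem exists_isGaussRule (hw : IsWeight w) (n : ℕ) :
    ∃ x lam : Fin n → ℝ, IsGaussRule w n x lam := by
  obtain ⟨p, hp⟩ := exists_isOrthPoly hw n
  obtain ⟨x, hx, hroot⟩ := hp.exists_zeros hw
  refine ⟨x, fun k => weightFunctional hw (Lagrange.basis Finset.univ x k), hx, ⟨p, hp, hroot⟩,
    fun f hf => ?_⟩
  rw [isOrthPoly_iff hw] at hp
  have hp0 : p ≠ 0 := by
    rintro rfl
    simp at hp
  have hn := natDegree_eq_of_degree_eq_some hp.1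
  have hdiv : p * (f / p) + f % p = f := EuclideanDomain.div_add_mod f p
  have hmod : (f % p).degree < n := by
    rw [← hp.1]
    exact EuclideanDomain.mod_lt f hp0
  have hquot : (f / p).degree < n := by
    rcases eq_or_ne (f / p) 0 with h | h
    · rw [h, degree_zero]; exact WithBot.bot_lt_coe n
    · have hle : p.degree ≤ f.degree := not_lt.1 fun hlt => h ((Polynomial.div_eq_zero_iff hp0).2 hlt)
      have hadd := congrArg natDegree hdiv
      rw [natDegree_add_eq_left_of_degree_lt, natDegree_mul hp0 h] at hadd
      · rw [← natDegree_lt_iff_degree_lt h]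
        omega
      · rw [degree_mul]
        exact (EuclideanDomain.mod_lt f hp0).trans_le
          (le_add_of_nonneg_right (zero_le_degree_iff.2 h))
  have hval : ∀ k, f.eval (x k) = (f % p).eval (x k) := fun k => by
    have h0 : p.eval (x k) = 0 := (hroot _).2 ⟨k, rfl⟩
    conv_lhs => rw [← hdiv, eval_add, eval_mul, h0, zero_mul, zero_add]
  rw [← weightFunctional_apply hw]
  have hinterp := Lagrange.eq_interpolate (f := f % p) (s := Finset.univ) (v := x) hx.injOn
    (by simpa using hmod)
  conv_lhs => rw [← hdiv, map_add, hp.2 _ hquot, zero_add, hinterp, Lagrange.interpolate_apply,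
    map_sum]
  refine Finset.sum_congr rfl fun k _ => ?_
  rw [hval, ← smul_eq_C_mul, map_smul, smul_eq_mul, mul_comm]

/-- The rule is tested on q² and (X - 1)q², where q vanishes at every node but the k-th. Both have
degree at most 2n - 1 and are nonnegative on [1, ∞). -/
theorem IsGaussRule.one_lt_and_pos (hw : IsWeight w) {n : ℕ} {x lam : Fin n → ℝ}
    (h : IsGaussRule w n x lam) (k : Fin n) : 1 < x k ∧ 0 < lam k := by
  have hn : 0 < n := k.pos
  let q : ℝ[X] := ∏ j ∈ Finset.univ.erase k, (X - C (x j))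
  have hq0 : q ≠ 0 := Finset.prod_ne_zero_iff.2 fun j _ => X_sub_C_ne_zero _
  have hqdeg : q.natDegree = n - 1 := by
    rw [natDegree_prod_of_monic _ _ fun j _ => monic_X_sub_C _]
    simp
  have hqval : ∀ j, j ≠ k → q.eval (x j) = 0 := fun j hj => by
    rw [eval_prod]
    exact Finset.prod_eq_zero (Finset.mem_erase.2 ⟨hj, Finset.mem_univ j⟩) (by simp)
  have hrule : ∀ f : ℝ[X], f.natDegree ≤ 1 →
      weightFunctional hw (f * (q * q)) = lam k * (f.eval (x k) * q.eval (x k) ^ 2) := by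
    intro f hf
    have hlt : (f * (q * q)).natDegree < 2 * n := by
      refine (natDegree_mul_le.trans (Nat.add_le_add hf natDegree_mul_le)).trans_lt ?_
      omega
    rw [weightFunctional_apply, h.exact _ hlt, Finset.sum_eq_single k]
    · simp only [eval_mul]; ring
    · intro j _ hj
      simp [hqval j hj]
    · simp
  have h1 : 0 < lam k * q.eval (x k) ^ 2 := by
    have := hrule 1 (by simp)
    rw [eval_one, one_mul, one_mul] at this
    rw [← this]
    refine weightFunctional_pos hw (by simpa using hq0) fun t _ => ?_
    rw [eval_mul]
    exact mul_self_nonneg _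
  have h2 : 0 < lam k * ((x k - 1) * q.eval (x k) ^ 2) := by
    have := hrule (X - C 1) (natDegree_X_sub_C_le _)
    rw [eval_sub, eval_X, eval_C] at this
    rw [← this]
    refine weightFunctional_pos hw (mul_ne_zero (X_sub_C_ne_zero 1) (mul_ne_zero hq0 hq0))
      fun t ht => ?_
    rw [eval_mul, eval_mul, eval_sub, eval_X, eval_C]
    exact mul_nonneg (by linarith) (mul_self_nonneg _)
  have hlam : 0 < lam k := pos_of_mul_pos_left h1 (sq_nonneg _)
  refine ⟨?_, hlam⟩
  have h3 := (mul_pos_iff_of_pos_left hlam).1 h2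
  have := pos_of_mul_pos_left h3 (sq_nonneg _)
  linarith

end gauss

/-! ### Polynomials of bounded degree in each of two variables -/

section bidegree

open Polynomial

variable {w : ℝ → ℝ}

/-- The polynomial functions on the plane of degree at most `d` in each variable. -/
def biPoly (d : ℕ) : Submodule ℝ (ℝ × ℝ → ℝ) :=
  Submodule.span ℝ {F | ∃ p q : ℝ[X], p.natDegree ≤ d ∧ q.natDegree ≤ d ∧
    F = fun z => p.eval z.1 * q.eval z.2}

theorem mem_biPoly_of_natDegree_le {d : ℕ} {p q : ℝ[X]} (hp : p.natDegree ≤ d)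
    (hq : q.natDegree ≤ d) : (fun z : ℝ × ℝ => p.eval z.1 * q.eval z.2) ∈ biPoly d :=
  Submodule.subset_span ⟨p, q, hp, hq, rfl⟩

theorem biPoly_mono {a b : ℕ} (h : a ≤ b) : biPoly a ≤ biPoly b :=
  Submodule.span_mono fun _ ⟨p, q, hp, hq, e⟩ => ⟨p, q, hp.trans h, hq.trans h, e⟩

theorem mul_mem_biPoly {a b : ℕ} {F G : ℝ × ℝ → ℝ} (hF : F ∈ biPoly a) (hG : G ∈ biPoly b) :
    F * G ∈ biPoly (a + b) := by
  have h := Submodule.mul_mem_mul hF hG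
  rw [biPoly, biPoly, Submodule.span_mul_span] at h
  refine Submodule.span_mono ?_ h
  rintro _ ⟨_, ⟨p, q, hp, hq, rfl⟩, _, ⟨p', q', hp', hq', rfl⟩, rfl⟩
  refine ⟨p * p', q * q', natDegree_mul_le.trans (add_le_add hp hp'),
    natDegree_mul_le.trans (add_le_add hq hq'), ?_⟩
  ext z
  simp only [Pi.mul_apply, eval_mul]
  ring

theorem const_mem_biPoly (c : ℝ) : (fun _ : ℝ × ℝ => c) ∈ biPoly 0 := by
  simpa using mem_biPoly_of_natDegree_le (d := 0) (p := C c) (q := 1) (by simp) (by simp)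

theorem half_add_mem_biPoly : (fun z : ℝ × ℝ => (z.1 + z.2) / 2) ∈ biPoly 1 := by
  have h1 := mem_biPoly_of_natDegree_le (d := 1) (p := X) (q := C (1 / 2)) (by simp) (by simp)
  have h2 := mem_biPoly_of_natDegree_le (d := 1) (p := C (1 / 2)) (q := X) (by simp) (by simp)
  convert Submodule.add_mem _ h1 h2 using 1
  ext z
  simp
  ring

theorem one_add_mul_mem_biPoly : (fun z : ℝ × ℝ => 1 + z.1 * z.2) ∈ biPoly 1 := by
  have h1 := mem_biPoly_of_natDegree_le (d := 1) (p := X) (q := X) (by simp) (by simp)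
  convert Submodule.add_mem _ (biPoly_mono zero_le_one (const_mem_biPoly 1)) h1 using 1
  ext z
  simp

theorem pow_mem_biPoly {F : ℝ × ℝ → ℝ} (hF : F ∈ biPoly 1) (k : ℕ) : F ^ k ∈ biPoly k := by
  induction k with
  | zero => exact const_mem_biPoly 1
  | succ k ih => rw [pow_succ]; exact mul_mem_biPoly ih hF

theorem eq_zero_of_mem_biPoly {d n : ℕ} (hd : d < n) {x : Fin n → ℝ} (hx : Function.Injective x)
    {F : ℝ × ℝ → ℝ} (hF : F ∈ biPoly d) (h : ∀ j k, F (x j, x k) = 0) (z : ℝ × ℝ) : F z = 0 := by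
  have h1 : ∀ a, ∃ p : ℝ[X], p.natDegree ≤ d ∧ ∀ b, F (a, b) = p.eval b := by
    intro a
    refine Submodule.span_induction ?_ ⟨0, by simp⟩ ?_ ?_ hF
    · rintro _ ⟨p, q, -, hq, rfl⟩
      exact ⟨C (p.eval a) * q, (natDegree_C_mul_le _ _).trans hq, by simp⟩
    · rintro G H - - ⟨p, hp, ep⟩ ⟨q, hq, eq⟩
      exact ⟨p + q, natDegree_add_le_of_degree_le hp hq, by simp [ep, eq]⟩
    · rintro c G - ⟨p, hp, ep⟩
      exact ⟨C c * p, (natDegree_C_mul_le _ _).trans hp, by simp [ep]⟩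
  have h2 : ∀ b, ∃ p : ℝ[X], p.natDegree ≤ d ∧ ∀ a, F (a, b) = p.eval a := by
    intro b
    refine Submodule.span_induction ?_ ⟨0, by simp⟩ ?_ ?_ hF
    · rintro _ ⟨p, q, hp, -, rfl⟩
      exact ⟨C (q.eval b) * p, (natDegree_C_mul_le _ _).trans hp, by simp [mul_comm]⟩
    · rintro G H - - ⟨p, hp, ep⟩ ⟨q, hq, eq⟩
      exact ⟨p + q, natDegree_add_le_of_degree_le hp hq, by simp [ep, eq]⟩
    · rintro c G - ⟨p, hp, ep⟩
      exact ⟨C c * p, (natDegree_C_mul_le _ _).trans hp, by simp [ep]⟩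
  have key : ∀ p : ℝ[X], p.natDegree ≤ d → (∀ j, p.eval (x j) = 0) → p = 0 := fun p hp hz =>
    eq_zero_of_natDegree_lt_card_of_eval_eq_zero p hx hz (by simpa using hp.trans_lt hd)
  have h3 : ∀ j b, F (x j, b) = 0 := by
    intro j b
    obtain ⟨p, hp, e⟩ := h1 (x j)
    rw [e, key p hp fun k => by rw [← e, h], eval_zero]
  obtain ⟨p, hp, e⟩ := h2 z.2
  rw [← Prod.mk.eta (p := z), e, key p hp fun j => by rw [← e, h3], eval_zero]

/-- The product Gauss rule. -/
theorem gauss_of_mem_biPoly (hw : IsWeight w) {d : ℕ} {F : ℝ × ℝ → ℝ} (hF : F ∈ biPoly d) :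
    IntegrableOn (fun z => F z * (w z.1 * w z.2)) (Set.Ici (1 : ℝ) ×ˢ Set.Ici (1 : ℝ)) ∧
    ∀ {n : ℕ} {x lam : Fin n → ℝ}, IsGaussRule w n x lam → d < 2 * n →
      normConst w ^ 2 * ∫ z in Set.Ici (1 : ℝ) ×ˢ Set.Ici (1 : ℝ), F z * (w z.1 * w z.2) =
        ∑ j, ∑ k, lam j * lam k * F (x j, x k) := by
  refine Submodule.span_induction ?_ ?_ ?_ ?_ hF
  · rintro _ ⟨p, q, hp, hq, rfl⟩
    have e : (fun z : ℝ × ℝ => p.eval z.1 * q.eval z.2 * (w z.1 * w z.2)) =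
        fun z => (p.eval z.1 * w z.1) * (q.eval z.2 * w z.2) := by
      ext z; ring
    simp only [e]
    constructor
    · rw [IntegrableOn, Measure.volume_eq_prod, ← Measure.prod_restrict]
      exact (hw.integrableOn_eval p).mul_prod (hw.integrableOn_eval q)
    · intro n x lam h hd
      rw [Measure.volume_eq_prod, setIntegral_prod_mul (fun t => p.eval t * w t)
        (fun t => q.eval t * w t), sq, mul_mul_mul_comm, h.exact p (by omega),
        h.exact q (by omega), Finset.sum_mul_sum]
      exact Finset.sum_congr rfl fun j _ => Finset.sum_congr rfl fun k _ => by ring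
  · simp
  · rintro G H - - ⟨hG, hG'⟩ ⟨hH, hH'⟩
    simp only [Pi.add_apply, add_mul]
    refine ⟨hG.add hH, fun h hd => ?_⟩
    rw [integral_add hG hH, mul_add, hG' h hd, hH' h hd, ← Finset.sum_add_distrib]
    refine Finset.sum_congr rfl fun j _ => ?_
    rw [← Finset.sum_add_distrib]
    exact Finset.sum_congr rfl fun k _ => by ring
  · rintro c G - ⟨hG, hG'⟩
    simp only [Pi.smul_apply, smul_eq_mul, mul_assoc]
    refine ⟨hG.const_mul c, fun h hd => ?_⟩
    rw [integral_const_mul, mul_left_comm, hG' h hd, Finset.mul_sum]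
    refine Finset.sum_congr rfl fun j _ => ?_
    rw [Finset.mul_sum]
    exact Finset.sum_congr rfl fun k _ => by ring

/-- The power sums `s^{2e} + t^{2e}` in terms of `X`, `Y`, where `2st = X + Y` and
`s² + t² = 1 + XY`. -/
theorem exists_biPoly_power_sum (e : ℕ) : ∃ F ∈ biPoly e, ∀ a b s t : ℝ,
    2 * s * t = a + b → s ^ 2 + t ^ 2 = 1 + a * b → F (a, b) = s ^ (2 * e) + t ^ (2 * e) := by
  induction e using Nat.twoStepInduction with
  | zero => exact ⟨_, const_mem_biPoly 2, fun a b s t _ _ => by norm_num⟩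
  | one => exact ⟨_, one_add_mul_mem_biPoly, fun a b s t _ h => by simpa using h.symm⟩
  | more e ih1 ih2 =>
    obtain ⟨F, hF, eF⟩ := ih1
    obtain ⟨G, hG, eG⟩ := ih2
    -- Newton's recursion for the power sums of s² and t², with s² + t² = 1 + XY and s²t² = ((X +
    -- Y)/2)².
    have h1 := mul_mem_biPoly hG one_add_mul_mem_biPoly
    have h2 := mul_mem_biPoly hF (pow_mem_biPoly half_add_mem_biPoly 2)
    refine ⟨_, Submodule.sub_mem _ h1 h2, fun a b s t hst hs => ?_⟩
    simp only [Pi.sub_apply, Pi.mul_apply, Pi.pow_apply, eF a b s t hst hs, eG a b s t hst hs,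
      ← hst, ← hs]
    ring

theorem fourSum_zero (s t : ℝ) : fourSum 0 s t = 0 := by simp [fourSum, evalAt]

theorem fourSum_add (f g : MvPolynomial (Fin 2) ℝ) (s t : ℝ) :
    fourSum (f + g) s t = fourSum f s t + fourSum g s t := by
  simp only [fourSum, evalAt, map_add]; ring

/-- The symmetrization of a polynomial of degree at most `2d + 1` has degree at most `d` in each
of the variables `X`, `Y`, where `2st = X + Y` and `s² + t² = 1 + XY`. -/
theorem exists_biPoly_fourSum {d : ℕ} {f : MvPolynomial (Fin 2) ℝ}
    (hf : f.totalDegree ≤ 2 * d + 1) : ∃ F ∈ biPoly d, ∀ a b s t : ℝ,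
    2 * s * t = a + b → s ^ 2 + t ^ 2 = 1 + a * b → F (a, b) = fourSum f s t := by
  rw [f.as_sum]
  refine Finset.sum_induction _ (fun f => ∃ F ∈ biPoly d, ∀ a b s t : ℝ,
    2 * s * t = a + b → s ^ 2 + t ^ 2 = 1 + a * b → F (a, b) = fourSum f s t) ?_ ?_ ?_
  · rintro f g ⟨F, hF, eF⟩ ⟨G, hG, eG⟩
    exact ⟨F + G, Submodule.add_mem _ hF hG, fun a b s t h1 h2 => by
      rw [fourSum_add, Pi.add_apply, eF a b s t h1 h2, eG a b s t h1 h2]⟩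
  · exact ⟨0, Submodule.zero_mem _, fun a b s t _ _ => by rw [fourSum_zero, Pi.zero_apply]⟩
  · intro m hm
    have hdeg := (MvPolynomial.le_totalDegree hm).trans hf
    rw [Finsupp.sum_fintype _ _ (fun _ => rfl), Fin.sum_univ_two] at hdeg
    generalize MvPolynomial.coeff m f = c
    have hval : ∀ s t : ℝ, fourSum (MvPolynomial.monomial m c) s t =
        c * (1 + (-1) ^ (m 0 + m 1)) * (s ^ m 0 * t ^ m 1 + t ^ m 0 * s ^ m 1) := by
      intro s t
      simp only [fourSum, evalAt, MvPolynomial.eval_monomial,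
        Finsupp.prod_fintype _ _ (fun _ => pow_zero _), Fin.prod_univ_two, Matrix.cons_val_zero,
        Matrix.cons_val_one, neg_pow s, neg_pow t, pow_add]
      ring
    -- Monomials of odd degree cancel. Those of even degree give (st)^k times the power sum s^(2e) +
    -- t^(2e), of degree at most k + e in each of X and Y.
    have main : ∀ k e : ℕ, k + e ≤ d → ∃ F ∈ biPoly d, ∀ a b s t : ℝ, 2 * s * t = a + b →
        s ^ 2 + t ^ 2 = 1 + a * b →
        F (a, b) = c * 2 * (s ^ k * t ^ (k + 2 * e) + t ^ k * s ^ (k + 2 * e)) := by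
      intro k e hke
      obtain ⟨G, hG, eG⟩ := exists_biPoly_power_sum e
      have h := mul_mem_biPoly (pow_mem_biPoly half_add_mem_biPoly k) hG
      refine ⟨_, Submodule.smul_mem _ (c * 2) (biPoly_mono hke h), fun a b s t h1 h2 => ?_⟩
      simp only [Pi.smul_apply, Pi.mul_apply, Pi.pow_apply, eG a b s t h1 h2, ← h1, smul_eq_mul]
      rw [show 2 * s * t / 2 = s * t by ring]
      ring
    rcases Nat.even_or_odd (m 0 + m 1) with h | h
    · simp only [hval, h.neg_one_pow, one_add_one_eq_two]
      obtain ⟨r, hr⟩ := h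
      rcases le_total (m 0) (m 1) with hle | hle
      · obtain ⟨F, hF, eF⟩ := main (m 0) (r - m 0) (by omega)
        refine ⟨F, hF, fun a b s t h1 h2 => ?_⟩
        rw [eF a b s t h1 h2, show m 0 + 2 * (r - m 0) = m 1 by omega]
      · obtain ⟨F, hF, eF⟩ := main (m 1) (r - m 1) (by omega)
        refine ⟨F, hF, fun a b s t h1 h2 => ?_⟩
        rw [eF a b s t h1 h2, show m 1 + 2 * (r - m 1) = m 0 by omega]
        ring
    · exact ⟨0, Submodule.zero_mem _, fun a b s t _ _ => by
        rw [hval, h.neg_one_pow, Pi.zero_apply]; ring⟩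

end bidegree

/-! ### The change of variables -/

section wedge

/-- The open wedge `1 < y < x`. -/
def wedge : Set (ℝ × ℝ) := {z | 1 < z.2 ∧ z.2 < z.1}

theorem isOpen_wedge : IsOpen wedge :=
  (isOpen_lt continuous_const continuous_snd).inter (isOpen_lt continuous_snd continuous_fst)

theorem measurableSet_wedge : MeasurableSet wedge := isOpen_wedge.measurableSet

theorem quadrant_ae_eq :
    (Set.Ici (1 : ℝ) ×ˢ Set.Ici (1 : ℝ) : Set (ℝ × ℝ)) =ᵐ[volume]
      (wedge ∪ Prod.swap ⁻¹' wedge : Set (ℝ × ℝ)) := by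
  have h1 : ∀ᵐ z : ℝ × ℝ, z.1 ≠ 1 := by
    have := Measure.quasiMeasurePreserving_fst (μ := (volume : Measure ℝ))
      (ν := (volume : Measure ℝ)) |>.preimage_null (s := {1}) (by simp)
    exact measure_eq_zero_iff_ae_notMem.1 this
  have h2 : ∀ᵐ z : ℝ × ℝ, z.2 ≠ 1 := by
    have := Measure.quasiMeasurePreserving_snd (μ := (volume : Measure ℝ))
      (ν := (volume : Measure ℝ)) |>.preimage_null (s := {1}) (by simp)
    exact measure_eq_zero_iff_ae_notMem.1 this
  have h3 : ∀ᵐ z : ℝ × ℝ, z.1 ≠ z.2 := by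
    have h : volume (LinearMap.ker (LinearMap.fst ℝ ℝ ℝ - LinearMap.snd ℝ ℝ ℝ) : Set (ℝ × ℝ))
        = 0 := by
      apply Measure.addHaar_submodule
      rw [Ne, LinearMap.ker_eq_top]
      intro h
      have : (LinearMap.fst ℝ ℝ ℝ - LinearMap.snd ℝ ℝ ℝ) (1, 0) = (0 : ℝ × ℝ →ₗ[ℝ] ℝ) (1, 0) := by
        rw [h]
      simp at this
    filter_upwards [measure_eq_zero_iff_ae_notMem.1 h] with z hz hne
    exact hz (by simp [hne])
  filter_upwards [h1, h2, h3] with z h1 h2 h3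
  refine propext ?_
  show (1 ≤ z.1 ∧ 1 ≤ z.2) ↔ (1 < z.2 ∧ z.2 < z.1) ∨ (1 < z.1 ∧ z.1 < z.2)
  constructor
  · rintro ⟨ha, hb⟩
    have ha := ha.lt_of_ne' h1
    have hb := hb.lt_of_ne' h2
    rcases lt_or_gt_of_ne h3 with h | h
    · exact .inr ⟨ha, h⟩
    · exact .inl ⟨hb, h⟩
  · rintro (⟨ha, hb⟩ | ⟨ha, hb⟩) <;> constructor <;> linarith

/-- Folding onto the wedge is needed because `coshMap` is invariant under the swap, hence not
injective on the quadrant. -/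
theorem quadrant_of_wedge {h : ℝ × ℝ → ℝ} (h1 : IntegrableOn h wedge)
    (h2 : IntegrableOn (fun z => h z.swap) wedge) :
    IntegrableOn h (Set.Ici (1 : ℝ) ×ˢ Set.Ici (1 : ℝ)) ∧
    ∫ z in Set.Ici (1 : ℝ) ×ˢ Set.Ici (1 : ℝ), h z = ∫ z in wedge, (h z + h z.swap) := by
  have hmp : MeasurePreserving (Prod.swap : ℝ × ℝ → ℝ × ℝ) volume volume :=
    Measure.measurePreserving_swap
  have hme : MeasurableEmbedding (Prod.swap : ℝ × ℝ → ℝ × ℝ) :=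
    MeasurableEquiv.prodComm.measurableEmbedding
  have hi : IntegrableOn h (Prod.swap ⁻¹' wedge) := by
    have := (hmp.integrableOn_comp_preimage hme (f := fun z => h z.swap) (s := wedge)).2 h2
    simpa [Function.comp_def] using this
  have hint : ∫ z in Prod.swap ⁻¹' wedge, h z = ∫ z in wedge, h z.swap := by
    simpa using hmp.setIntegral_preimage_emb hme (fun z => h z.swap) wedge
  have hdisj : Disjoint wedge (Prod.swap ⁻¹' wedge) := by
    rw [Set.disjoint_left]
    rintro z ⟨-, ha⟩ ⟨-, hb⟩
    exact lt_asymm ha hb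
  refine ⟨(integrableOn_congr_set_ae quadrant_ae_eq).2 (h1.union hi), ?_⟩
  rw [setIntegral_congr_set quadrant_ae_eq,
    setIntegral_union hdisj (hmp.measurable measurableSet_wedge) h1 hi, hint,
    integral_add h1 h2]

theorem domG_of_quadrant {h : ℝ × ℝ → ℝ}
    (h1 : IntegrableOn h (Set.Ici (1 : ℝ) ×ˢ Set.Ici (1 : ℝ)))
    (h2 : IntegrableOn (fun z => h (-z)) (Set.Ici (1 : ℝ) ×ˢ Set.Ici (1 : ℝ))) :
    IntegrableOn h domG ∧
    ∫ z in domG, h z = ∫ z in Set.Ici (1 : ℝ) ×ˢ Set.Ici (1 : ℝ), (h z + h (-z)) := by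
  have hmp : MeasurePreserving (Neg.neg : ℝ × ℝ → ℝ × ℝ) volume volume :=
    Measure.measurePreserving_neg _
  have hme : MeasurableEmbedding (Neg.neg : ℝ × ℝ → ℝ × ℝ) :=
    (MeasurableEquiv.neg (ℝ × ℝ)).measurableEmbedding
  have hset : (Set.Iic (-1 : ℝ) ×ˢ Set.Iic (-1 : ℝ) : Set (ℝ × ℝ)) =
      Neg.neg ⁻¹' (Set.Ici (1 : ℝ) ×ˢ Set.Ici (1 : ℝ)) := by
    ext z
    simp
  have hi : IntegrableOn h (Set.Iic (-1 : ℝ) ×ˢ Set.Iic (-1 : ℝ)) := by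
    have := (hmp.integrableOn_comp_preimage hme (f := fun z => h (-z))
      (s := Set.Ici (1 : ℝ) ×ˢ Set.Ici (1 : ℝ))).2 h2
    rw [hset]
    simpa [Function.comp_def] using this
  have hint : ∫ z in Set.Iic (-1 : ℝ) ×ˢ Set.Iic (-1 : ℝ), h z =
      ∫ z in Set.Ici (1 : ℝ) ×ˢ Set.Ici (1 : ℝ), h (-z) := by
    rw [hset]
    simpa using hmp.setIntegral_preimage_emb hme (fun z => h (-z))
      (Set.Ici (1 : ℝ) ×ˢ Set.Ici (1 : ℝ))
  have hdisj : Disjoint (Set.Iic (-1 : ℝ) ×ˢ Set.Iic (-1 : ℝ) : Set (ℝ × ℝ))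
      (Set.Ici (1 : ℝ) ×ˢ Set.Ici (1 : ℝ)) := by
    rw [Set.disjoint_left]
    rintro z ⟨ha, -⟩ ⟨hb, -⟩
    simp only [Set.mem_Iic, Set.mem_Ici] at ha hb
    linarith
  refine ⟨hi.union h1, ?_⟩
  rw [domG, setIntegral_union hdisj (measurableSet_Ici.prod measurableSet_Ici) hi h1, hint,
    integral_add h1 h2, add_comm]

/-- The map `(cosh a, cosh b) ↦ (cosh (a + b), cosh (a - b))`. -/
def coshMap (z : ℝ × ℝ) : ℝ × ℝ :=
  (z.1 * z.2 + √((z.1 ^ 2 - 1) * (z.2 ^ 2 - 1)), z.1 * z.2 - √((z.1 ^ 2 - 1) * (z.2 ^ 2 - 1)))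

theorem coshMap_add (z : ℝ × ℝ) : 2 * z.1 * z.2 = (coshMap z).1 + (coshMap z).2 := by
  simp only [coshMap]; ring

theorem coshMap_mul {z : ℝ × ℝ} (hz : 0 ≤ (z.1 ^ 2 - 1) * (z.2 ^ 2 - 1)) :
    z.1 ^ 2 + z.2 ^ 2 = 1 + (coshMap z).1 * (coshMap z).2 := by
  have := Real.sq_sqrt hz
  simp only [coshMap]
  linear_combination this

theorem disc_pos {z : ℝ × ℝ} (hz : z ∈ wedge) : 0 < (z.1 ^ 2 - 1) * (z.2 ^ 2 - 1) := by
  obtain ⟨h1, h2⟩ := hz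
  exact mul_pos (by nlinarith) (by nlinarith)

theorem coshMap_cosh {a b : ℝ} (ha : 0 ≤ a) (hb : 0 ≤ b) :
    coshMap (Real.cosh a, Real.cosh b) = (Real.cosh (a + b), Real.cosh (a - b)) := by
  have h : √((Real.cosh a ^ 2 - 1) * (Real.cosh b ^ 2 - 1)) = Real.sinh a * Real.sinh b := by
    rw [← Real.sinh_sq, ← Real.sinh_sq, ← mul_pow, Real.sqrt_sq]
    exact mul_nonneg (Real.sinh_nonneg_iff.2 ha) (Real.sinh_nonneg_iff.2 hb)
  simp only [coshMap, h, Real.cosh_add, Real.cosh_sub]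

/-- The image determines (s + t)² and (s - t)², and on the wedge s + t and s - t are positive. -/
theorem injOn_coshMap : Set.InjOn coshMap wedge := by
  intro z hz z' hz' h
  have h1 := coshMap_add z
  have h2 := coshMap_mul (disc_pos hz).le
  rw [h, ← coshMap_add z'] at h1
  rw [h, ← coshMap_mul (disc_pos hz').le] at h2
  obtain ⟨ha, hb⟩ := hz
  obtain ⟨ha', hb'⟩ := hz'
  have e1 : z.1 + z.2 = z'.1 + z'.2 := by
    rw [← sq_eq_sq₀ (by linarith) (by linarith)]
    linear_combination h1 + h2
  have e2 : z.1 - z.2 = z'.1 - z'.2 := by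
    rw [← sq_eq_sq₀ (by linarith) (by linarith)]
    linear_combination h2 - h1
  ext <;> linarith

/-- In hyperbolic coordinates the wedge is 0 < b < a and the map is (a, b) ↦ (a + b, a - b),
inverted by half sums and half differences. -/
theorem coshMap_image_wedge : coshMap '' wedge = wedge := by
  have hmono : ∀ {a b : ℝ}, 0 ≤ a → a < b → Real.cosh a < Real.cosh b := fun ha hab => by
    rw [Real.cosh_lt_cosh, abs_of_nonneg ha, abs_of_pos (ha.trans_lt hab)]
    exact hab
  have hrep : ∀ z ∈ wedge, ∃ a b : ℝ, 0 < b ∧ b < a ∧ z = (Real.cosh a, Real.cosh b) := by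
    rintro z ⟨h1, h2⟩
    refine ⟨Real.arcosh z.1, Real.arcosh z.2, Real.arcosh_pos h1,
      (Real.arcosh_lt_arcosh (by linarith) (by linarith)).2 h2, ?_⟩
    rw [Real.cosh_arcosh h1.le, Real.cosh_arcosh (h1.trans h2).le]
  have hmem : ∀ {a b : ℝ}, 0 < b → b < a → (Real.cosh a, Real.cosh b) ∈ wedge := fun hb hab =>
    ⟨Real.one_lt_cosh.2 hb.ne', hmono hb.le hab⟩
  ext z
  constructor
  · rintro ⟨z, hz, rfl⟩
    obtain ⟨a, b, hb, hab, rfl⟩ := hrep z hz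
    rw [coshMap_cosh (hb.trans hab).le hb.le]
    exact hmem (by linarith) (by linarith)
  · intro hz
    obtain ⟨a, b, hb, hab, rfl⟩ := hrep z hz
    refine ⟨(Real.cosh ((a + b) / 2), Real.cosh ((a - b) / 2)),
      hmem (by linarith) (by linarith), ?_⟩
    rw [coshMap_cosh (by linarith) (by linarith)]
    congr 2 <;> ring

/-- The derivative of `coshMap`. -/
def fderivCoshMap (z : ℝ × ℝ) : ℝ × ℝ →L[ℝ] ℝ × ℝ :=
  (Matrix.toLin (.finTwoProd ℝ) (.finTwoProd ℝ)
    !![z.2 + z.1 * (z.2 ^ 2 - 1) / √((z.1 ^ 2 - 1) * (z.2 ^ 2 - 1)),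
      z.1 + z.2 * (z.1 ^ 2 - 1) / √((z.1 ^ 2 - 1) * (z.2 ^ 2 - 1));
      z.2 - z.1 * (z.2 ^ 2 - 1) / √((z.1 ^ 2 - 1) * (z.2 ^ 2 - 1)),
      z.1 - z.2 * (z.1 ^ 2 - 1) / √((z.1 ^ 2 - 1) * (z.2 ^ 2 - 1))]).toContinuousLinearMap

theorem hasFDerivAt_coshMap {z : ℝ × ℝ} (hz : z ∈ wedge) :
    HasFDerivAt coshMap (fderivCoshMap z) z := by
  have hD := disc_pos hz
  have hx : HasFDerivAt (fun z : ℝ × ℝ => z.1) (ContinuousLinearMap.fst ℝ ℝ ℝ) z :=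
    hasFDerivAt_fst
  have hy : HasFDerivAt (fun z : ℝ × ℝ => z.2) (ContinuousLinearMap.snd ℝ ℝ ℝ) z :=
    hasFDerivAt_snd
  have hr := (((hx.pow 2).sub_const 1).mul ((hy.pow 2).sub_const 1)).sqrt hD.ne'
  have h := ((hx.mul hy).add hr).prodMk ((hx.mul hy).sub hr)
  refine h.congr_fderiv ?_
  rw [fderivCoshMap, Matrix.toLin_finTwoProd_toContinuousLinearMap]
  have hr0 := (Real.sqrt_pos.2 hD).ne'
  ext <;> simp <;> field_simp

theorem abs_det_fderivCoshMap {z : ℝ × ℝ} (hz : z ∈ wedge) :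
    |(fderivCoshMap z).det| =
      2 * (z.1 ^ 2 - z.2 ^ 2) / √((z.1 ^ 2 - 1) * (z.2 ^ 2 - 1)) := by
  have hr0 := Real.sqrt_pos.2 (disc_pos hz)
  have h : (fderivCoshMap z).det =
      -(2 * (z.1 ^ 2 - z.2 ^ 2) / √((z.1 ^ 2 - 1) * (z.2 ^ 2 - 1))) := by
    simp only [fderivCoshMap, LinearMap.det_toContinuousLinearMap, LinearMap.det_toLin,
      Matrix.det_fin_two_of]
    field_simp
    ring
  rw [h, abs_neg, abs_of_nonneg]
  obtain ⟨h1, h2⟩ := hz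
  exact div_nonneg (by nlinarith) hr0.le

theorem calW_neg_half {w : ℝ → ℝ} {z : ℝ × ℝ} (hz : z ∈ wedge) :
    calW w (-1 / 2) z = 1 / 4 * |(fderivCoshMap z).det| *
      (w (coshMap z).1 * w (coshMap z).2) := by
  have hD := disc_pos hz
  have e1 : 2 * z.1 * z.2 = (coshMap z).1 + (coshMap z).2 := coshMap_add z
  have e2 : z.1 ^ 2 + z.2 ^ 2 - 1 = (coshMap z).1 * (coshMap z).2 := by
    rw [coshMap_mul hD.le]; ring
  have e3 : ((coshMap z).1 + (coshMap z).2) ^ 2 - 4 * ((coshMap z).1 * (coshMap z).2) =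
      2 ^ 2 * ((z.1 ^ 2 - 1) * (z.2 ^ 2 - 1)) := by
    rw [← e1, ← e2]; ring
  have e4 : |2 ^ 2 * ((z.1 ^ 2 - 1) * (z.2 ^ 2 - 1))| ^ (-1 / 2 : ℝ) =
      (2 * √((z.1 ^ 2 - 1) * (z.2 ^ 2 - 1)))⁻¹ := by
    rw [abs_of_pos (by positivity), neg_div, Real.rpow_neg (by positivity), ← Real.sqrt_eq_rpow,
      Real.sqrt_mul (by positivity), Real.sqrt_sq (by norm_num)]
  rw [calW, e1, e2, weightW_add_mul, e3, e4, abs_det_fderivCoshMap hz, abs_of_nonneg]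
  · have hr0 := Real.sqrt_pos.2 hD
    field_simp
    ring
  · obtain ⟨h1, h2⟩ := hz
    nlinarith

theorem integrableOn_wedge_iff {w : ℝ → ℝ} (K : ℝ × ℝ → ℝ) :
    IntegrableOn (fun z => K (coshMap z) * calW w (-1 / 2) z) wedge ↔
      IntegrableOn (fun z => K z * (w z.1 * w z.2)) wedge := by
  have h := integrableOn_image_iff_integrableOn_abs_det_fderiv_smul volume measurableSet_wedge
    (fun z hz => (hasFDerivAt_coshMap hz).hasFDerivWithinAt) injOn_coshMap
    (fun z => K z * (w z.1 * w z.2))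
  rw [coshMap_image_wedge] at h
  rw [h]
  refine (integrable_const_mul_iff (IsUnit.mk0 (4 : ℝ) (by norm_num)) _).symm.trans ?_
  refine integrableOn_congr_fun (fun z hz => ?_) measurableSet_wedge
  simp only [calW_neg_half hz, smul_eq_mul]
  ring

theorem setIntegral_wedge {w : ℝ → ℝ} (K : ℝ × ℝ → ℝ) :
    ∫ z in wedge, K (coshMap z) * calW w (-1 / 2) z =
      1 / 4 * ∫ z in wedge, K z * (w z.1 * w z.2) := by
  have h := integral_image_eq_integral_abs_det_fderiv_smul volume measurableSet_wedge
    (fun z hz => (hasFDerivAt_coshMap hz).hasFDerivWithinAt) injOn_coshMap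
    (fun z => K z * (w z.1 * w z.2))
  rw [coshMap_image_wedge] at h
  rw [h, ← integral_const_mul]
  refine setIntegral_congr_fun measurableSet_wedge fun z hz => ?_
  simp only [calW_neg_half hz, smul_eq_mul]
  ring

end wedge

/-! ### The two functionals -/

section functionals

variable {w : ℝ → ℝ}

theorem evalAt_mul (f g : MvPolynomial (Fin 2) ℝ) (z : ℝ × ℝ) :
    evalAt (f * g) z = evalAt f z * evalAt g z := by simp [evalAt]

theorem evalAt_add (f g : MvPolynomial (Fin 2) ℝ) (z : ℝ × ℝ) :
    evalAt (f + g) z = evalAt f z + evalAt g z := by simp [evalAt]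

theorem evalAt_smul (a : ℝ) (f : MvPolynomial (Fin 2) ℝ) (z : ℝ × ℝ) :
    evalAt (a • f) z = a * evalAt f z := by simp [evalAt]

theorem continuous_evalAt (f : MvPolynomial (Fin 2) ℝ) : Continuous (evalAt f) := by
  refine (MvPolynomial.continuous_eval f).comp (continuous_pi fun i => ?_)
  fin_cases i
  · exact continuous_fst
  · exact continuous_snd

theorem evalAt_eq_zero_of_Ioi {f : MvPolynomial (Fin 2) ℝ}
    (h : ∀ s t : ℝ, 1 < s → 1 < t → evalAt f (s, t) = 0) : f = 0 := by
  refine MvPolynomial.funext_set (fun _ => Set.Ioi (1 : ℝ)) (fun _ => Set.Ioi_infinite 1)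
    fun z hz => ?_
  have e : z = ![z 0, z 1] := by ext i; fin_cases i <;> rfl
  rw [map_zero, e]
  exact h (z 0) (z 1) (hz 0 trivial) (hz 1 trivial)

theorem calW_swap (w : ℝ → ℝ) (γ : ℝ) (z : ℝ × ℝ) : calW w γ z.swap = calW w γ z := by
  simp only [calW, Prod.fst_swap, Prod.snd_swap]
  rw [mul_right_comm, add_comm (z.2 ^ 2), abs_sub_comm]

theorem calW_neg (w : ℝ → ℝ) (γ : ℝ) (z : ℝ × ℝ) : calW w γ (-z) = calW w γ z := by
  simp only [calW, Prod.fst_neg, Prod.snd_neg, neg_sq]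
  rw [mul_assoc, neg_mul_neg, ← mul_assoc]

theorem calW_nonneg_of_wedge (hw : IsWeight w) {z : ℝ × ℝ} (hz : z ∈ wedge) :
    0 ≤ calW w (-1 / 2) z := by
  have h : coshMap z ∈ wedge := coshMap_image_wedge ▸ Set.mem_image_of_mem _ hz
  rw [calW_neg_half hz]
  exact mul_nonneg (by positivity)
    (mul_nonneg (hw.nonneg _ (h.1.trans h.2).le) (hw.nonneg _ h.1.le))

theorem integrableOn_wedge_fourSum (hw : IsWeight w) (f : MvPolynomial (Fin 2) ℝ) :
    IntegrableOn (fun z => fourSum f z.1 z.2 * calW w (-1 / 2) z) wedge := by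
  obtain ⟨F, hF, eF⟩ := exists_biPoly_fourSum (d := f.totalDegree) (f := f) (by omega)
  have h := (integrableOn_wedge_iff (w := w) F).2 ((gauss_of_mem_biPoly hw hF).1.mono_set
    fun z hz => ⟨(hz.1.trans hz.2).le, hz.1.le⟩)
  refine (integrableOn_congr_fun (fun z hz => ?_) measurableSet_wedge).1 h
  rw [← Prod.mk.eta (p := coshMap z), eF _ _ _ _ (coshMap_add z) (coshMap_mul (disc_pos hz).le)]

/-- The change of variables only controls symmetrized polynomials. A single summand is dominated by
4 plus the symmetrization of a square. -/
theorem integrableOn_wedge_of_sq_le (hw : IsWeight w) {g : ℝ × ℝ → ℝ} (hg : Continuous g)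
    {f : MvPolynomial (Fin 2) ℝ} (h : ∀ z : ℝ × ℝ, g z ^ 2 ≤ fourSum f z.1 z.2) :
    IntegrableOn (fun z => g z * calW w (-1 / 2) z) wedge := by
  have h1 : ∀ s t, fourSum 1 s t = 4 := fun s t => by simp [fourSum, evalAt]; norm_num
  -- No measurability of w is assumed directly, so that of the weight is read off from the
  -- integrable case f = 1.
  have hmeas : AEStronglyMeasurable (calW w (-1 / 2)) (volume.restrict wedge) := by
    have := ((integrableOn_wedge_fourSum hw 1).const_mul (1 / 4)).aestronglyMeasurable
    simpa [h1] using this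
  refine (integrableOn_wedge_fourSum hw (1 + f)).mono'
    (hg.aestronglyMeasurable.mul hmeas) ?_
  refine (ae_restrict_iff' measurableSet_wedge).2 (ae_of_all _ fun z hz => ?_)
  have hc := calW_nonneg_of_wedge hw hz
  rw [norm_mul, Real.norm_of_nonneg hc, fourSum_add, h1]
  refine mul_le_mul_of_nonneg_right ?_ hc
  have := h z
  rw [Real.norm_eq_abs]
  have := abs_le_of_sq_le_sq' (a := g z) (b := 4 + fourSum f z.1 z.2)
    (by nlinarith [sq_nonneg (g z)]) (by nlinarith [sq_nonneg (g z)])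
  exact abs_le.2 this

theorem domG_eq_wedge (hw : IsWeight w) (f : MvPolynomial (Fin 2) ℝ) :
    IntegrableOn (fun z => evalAt f z * calW w (-1 / 2) z) domG ∧
    ∫ z in domG, evalAt f z * calW w (-1 / 2) z =
      ∫ z in wedge, fourSum f z.1 z.2 * calW w (-1 / 2) z := by
  have hc := continuous_evalAt f
  have hsq : ∀ z : ℝ × ℝ, fourSum (f * f) z.1 z.2 = evalAt f z ^ 2 + evalAt f z.swap ^ 2 +
      evalAt f (-z) ^ 2 + evalAt f (-z.swap) ^ 2 := fun z => by
    simp only [fourSum, evalAt_mul]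
    simp only [← sq]
    rfl
  have i1 : IntegrableOn (fun z => evalAt f z * calW w (-1 / 2) z) wedge :=
    integrableOn_wedge_of_sq_le hw (f := f * f) hc fun z => by
      rw [hsq]
      linarith [sq_nonneg (evalAt f z.swap), sq_nonneg (evalAt f (-z)),
        sq_nonneg (evalAt f (-z.swap))]
  have i2 : IntegrableOn (fun z => evalAt f z.swap * calW w (-1 / 2) z) wedge :=
    integrableOn_wedge_of_sq_le hw (f := f * f) (hc.comp continuous_swap) fun z => by
      rw [hsq]
      linarith [sq_nonneg (evalAt f z), sq_nonneg (evalAt f (-z)),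
        sq_nonneg (evalAt f (-z.swap))]
  have i3 : IntegrableOn (fun z => evalAt f (-z) * calW w (-1 / 2) z) wedge :=
    integrableOn_wedge_of_sq_le hw (f := f * f) (hc.comp continuous_neg) fun z => by
      rw [hsq]
      linarith [sq_nonneg (evalAt f z.swap), sq_nonneg (evalAt f z),
        sq_nonneg (evalAt f (-z.swap))]
  have i4 : IntegrableOn (fun z => evalAt f (-z.swap) * calW w (-1 / 2) z) wedge :=
    integrableOn_wedge_of_sq_le hw (f := f * f)
      (hc.comp (continuous_neg.comp continuous_swap)) fun z => by
      rw [hsq]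
      linarith [sq_nonneg (evalAt f z.swap), sq_nonneg (evalAt f (-z)),
        sq_nonneg (evalAt f z)]
  have q1 := quadrant_of_wedge i1 (by simpa only [calW_swap] using i2)
  have q2 := quadrant_of_wedge i3 (by simpa only [calW_swap] using i4)
  have q3 := quadrant_of_wedge (i1.add i3) (by
    simp only [Pi.add_apply, calW_swap]
    exact i2.add i4)
  have g := domG_of_quadrant q1.1 (by simpa only [calW_neg] using q2.1)
  refine ⟨g.1, ?_⟩
  rw [g.2]
  simp only [calW_neg]
  refine q3.2.trans (setIntegral_congr_fun measurableSet_wedge fun z _ => ?_)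
  have e : fourSum f z.1 z.2 =
      evalAt f z + evalAt f z.swap + evalAt f (-z) + evalAt f (-z.swap) := rfl
  simp only [Pi.add_apply, calW_swap, e]
  ring

/-! ### Hyperbolic identities for the nodes -/

section nodes

variable {n : ℕ} {x : Fin n → ℝ}

theorem cosh_theta {k : Fin n} (h : 1 < x k) : Real.cosh (theta x k) = x k :=
  Real.cosh_arcosh h.le

theorem two_mul_sNode_mul_tNode (j k : Fin n) : 2 * sNode x j k * tNode x j k =
    Real.cosh (theta x j) + Real.cosh (theta x k) := by
  have h1 : theta x j = theta x j / 2 + theta x j / 2 := by ring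
  have h2 : theta x k = theta x k / 2 + theta x k / 2 := by ring
  rw [sNode, tNode, sub_div, add_div, Real.cosh_add, Real.cosh_sub]
  conv_rhs => rw [h1, h2, Real.cosh_add, Real.cosh_add]
  have e1 := Real.cosh_sq (theta x j / 2)
  have e2 := Real.cosh_sq (theta x k / 2)
  linear_combination (2 * Real.cosh (theta x k / 2) ^ 2 - 1) * e1 +
    (1 + 2 * Real.sinh (theta x j / 2) ^ 2) * e2

theorem sNode_sq_add_tNode_sq (j k : Fin n) : sNode x j k ^ 2 + tNode x j k ^ 2 =
    1 + Real.cosh (theta x j) * Real.cosh (theta x k) := by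
  have h1 : theta x j = theta x j / 2 + theta x j / 2 := by ring
  have h2 : theta x k = theta x k / 2 + theta x k / 2 := by ring
  rw [sNode, tNode, sub_div, add_div, Real.cosh_add, Real.cosh_sub]
  conv_rhs => rw [h1, h2, Real.cosh_add, Real.cosh_add]
  have e1 := Real.cosh_sq (theta x j / 2)
  have e2 := Real.cosh_sq (theta x k / 2)
  linear_combination (Real.cosh (theta x k / 2) ^ 2 - Real.sinh (theta x k / 2) ^ 2) * e1 + e2

theorem sNode_comm (j k : Fin n) : sNode x j k = sNode x k j := by
  rw [sNode, sNode, ← Real.cosh_neg, ← neg_div, neg_sub]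

theorem tNode_comm (j k : Fin n) : tNode x j k = tNode x k j := by
  rw [tNode, tNode, add_comm]

end nodes

/-- The integral over `G` for the exponent `-1/2` as a product Gauss rule. -/
theorem setIntegral_domG_eq_sum (hw : IsWeight w) {d n : ℕ} {f : MvPolynomial (Fin 2) ℝ}
    (hf : f.totalDegree ≤ 2 * d + 1) (hd : d < 2 * n) {x lam : Fin n → ℝ}
    (h : IsGaussRule w n x lam) :
    normConst w ^ 2 * ∫ z in domG, evalAt f z * calW w (-1 / 2) z =
      1 / 8 * ∑ j, ∑ k, lam j * lam k * fourSum f (sNode x j k) (tNode x j k) := by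
  obtain ⟨F, hF, eF⟩ := exists_biPoly_fourSum hf
  have e1 : ∀ z ∈ wedge, fourSum f z.1 z.2 * calW w (-1 / 2) z =
      F (coshMap z) * calW w (-1 / 2) z := fun z hz => by
    rw [← Prod.mk.eta (p := coshMap z), eF _ _ _ _ (coshMap_add z) (coshMap_mul (disc_pos hz).le)]
  -- F is prescribed only at pairs (X, Y) arising from some s, t. Every point of the wedge is such a
  -- pair, and the relations are symmetric in X and Y.
  have hsymm : ∀ z ∈ wedge, F z.swap = F z := by
    intro z hz
    rw [← coshMap_image_wedge] at hz
    obtain ⟨z, hz, rfl⟩ := hz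
    have h1 := coshMap_add z
    have h2 := coshMap_mul (disc_pos hz).le
    rw [Prod.swap, eF _ _ _ _ (by rw [h1, add_comm]) (by rw [h2, mul_comm]),
      ← eF _ _ _ _ h1 h2]
  obtain ⟨hint, hrule⟩ := gauss_of_mem_biPoly hw hF
  have i1 : IntegrableOn (fun z => F z * (w z.1 * w z.2)) wedge :=
    hint.mono_set fun z hz => ⟨(hz.1.trans hz.2).le, hz.1.le⟩
  have e2 : ∀ z ∈ wedge, F z.swap * (w z.swap.1 * w z.swap.2) = F z * (w z.1 * w z.2) :=
    fun z hz => by rw [hsymm z hz, Prod.fst_swap, Prod.snd_swap, mul_comm (w z.2)]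
  have i2 : IntegrableOn (fun z => F z.swap * (w z.swap.1 * w z.swap.2)) wedge :=
    (integrableOn_congr_fun e2 measurableSet_wedge).2 i1
  have hq := (quadrant_of_wedge i1 i2).2
  rw [setIntegral_congr_fun measurableSet_wedge fun z hz => congrArg _ (e2 z hz),
    integral_add i1 i1] at hq
  have hr := hrule h hd
  rw [(domG_eq_wedge hw f).2, setIntegral_congr_fun measurableSet_wedge e1, setIntegral_wedge]
  rw [hq] at hr
  have e3 : ∑ j, ∑ k, lam j * lam k * fourSum f (sNode x j k) (tNode x j k) =
      ∑ j, ∑ k, lam j * lam k * F (x j, x k) := by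
    refine Finset.sum_congr rfl fun j _ => Finset.sum_congr rfl fun k _ => ?_
    have hj := cosh_theta (h.one_lt_and_pos hw j).1
    have hk := cosh_theta (h.one_lt_and_pos hw k).1
    rw [eF _ _ (sNode x j k) (tNode x j k) (by rw [two_mul_sNode_mul_tNode, hj, hk])
      (by rw [sNode_sq_add_tNode_sq, hj, hk])]
  -- The factor 1/8 combines the 1/4 from the Jacobian with the 1/2 from passing from the wedge to
  -- the quadrant.
  rw [e3, ← hr]
  ring

/-- The functional `f ↦ c_w² ∫_G f 𝒲_{-1/2}`. -/
def functionalMinus (hw : IsWeight w) : MvPolynomial (Fin 2) ℝ →ₗ[ℝ] ℝ where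
  toFun f := normConst w ^ 2 * ∫ z in domG, evalAt f z * calW w (-1 / 2) z
  map_add' f g := by
    rw [← mul_add, ← integral_add (domG_eq_wedge hw f).1 (domG_eq_wedge hw g).1]
    simp only [evalAt_add, add_mul]
  map_smul' a f := by
    simp only [evalAt_smul, mul_assoc, integral_const_mul, RingHom.id_apply, smul_eq_mul]
    ring

theorem functionalMinus_apply (hw : IsWeight w) (f : MvPolynomial (Fin 2) ℝ) :
    functionalMinus hw f = normConst w ^ 2 * ∫ z in domG, evalAt f z * calW w (-1 / 2) z := rfl

theorem functionalMinus_negVars (hw : IsWeight w) (f : MvPolynomial (Fin 2) ℝ) :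
    functionalMinus hw (negVars f) = functionalMinus hw f := by
  have h : ∀ s t, fourSum (negVars f) s t = fourSum f s t := fun s t => by
    simp only [fourSum, evalAt_negVars, neg_neg]; ring
  simp only [functionalMinus_apply, domG_eq_wedge hw, h]

/-- A Gauss rule with enough nodes expresses the integral as a sum of nonnegative terms. If it is
zero, the symmetrization F vanishes on a grid too large for its degree, so F = 0. Nonnegativity of
the four summands then forces f = 0 on an open quadrant. -/
theorem functionalMinus_pos (hw : IsWeight w) {f : MvPolynomial (Fin 2) ℝ} (h0 : f ≠ 0)
    (hf : ∀ s t, 1 ≤ s → 1 ≤ t → 0 ≤ evalAt f (s, t) ∧ 0 ≤ evalAt f (-s, -t)) :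
    0 < functionalMinus hw f := by
  set d := f.totalDegree
  obtain ⟨x, lam, h⟩ := exists_isGaussRule hw (d + 1)
  have hdeg : f.totalDegree ≤ 2 * d + 1 := by omega
  rw [functionalMinus_apply, setIntegral_domG_eq_sum hw hdeg (by omega) h]
  have hpos : ∀ s t, 1 ≤ s → 1 ≤ t → 0 ≤ fourSum f s t := fun s t hs ht =>
    add_nonneg (add_nonneg (add_nonneg (hf s t hs ht).1 (hf t s ht hs).1) (hf s t hs ht).2)
      (hf t s ht hs).2
  have hterm : ∀ j k, 0 ≤ lam j * lam k * fourSum f (sNode x j k) (tNode x j k) := fun j k =>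
    mul_nonneg (mul_nonneg (h.one_lt_and_pos hw j).2.le (h.one_lt_and_pos hw k).2.le)
      (hpos _ _ (Real.one_le_cosh _) (Real.one_le_cosh _))
  have hsum : ∀ j, 0 ≤ ∑ k, lam j * lam k * fourSum f (sNode x j k) (tNode x j k) := fun j =>
    Finset.sum_nonneg fun k _ => hterm j k
  refine mul_pos (by norm_num) ((Finset.sum_nonneg fun j _ => hsum j).lt_of_ne' fun hzero => h0 ?_)
  have hz : ∀ j k, fourSum f (sNode x j k) (tNode x j k) = 0 := by
    intro j k
    have h1 := (Finset.sum_eq_zero_iff_of_nonneg fun j _ => hsum j).1 hzero j (Finset.mem_univ j)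
    have h2 := (Finset.sum_eq_zero_iff_of_nonneg fun k _ => hterm j k).1 h1 k (Finset.mem_univ k)
    exact (mul_eq_zero.1 h2).resolve_left
      (mul_pos (h.one_lt_and_pos hw j).2 (h.one_lt_and_pos hw k).2).ne'
  obtain ⟨F, hF, eF⟩ := exists_biPoly_fourSum hdeg
  have hF0 := eq_zero_of_mem_biPoly d.lt_succ_self h.injective hF fun j k => by
    have hj := cosh_theta (h.one_lt_and_pos hw j).1
    have hk := cosh_theta (h.one_lt_and_pos hw k).1
    rw [eF _ _ (sNode x j k) (tNode x j k) (by rw [two_mul_sNode_mul_tNode, hj, hk])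
      (by rw [sNode_sq_add_tNode_sq, hj, hk]), hz]
  refine evalAt_eq_zero_of_Ioi fun s t hs ht => ?_
  have hD : 0 ≤ (s ^ 2 - 1) * (t ^ 2 - 1) := mul_nonneg (by nlinarith) (by nlinarith)
  have h4 := eF _ _ _ _ (coshMap_add (s, t)) (coshMap_mul (z := (s, t)) hD)
  rw [hF0] at h4
  have h5 := hf s t hs.le ht.le
  have h6 := hf t s ht.le hs.le
  simp only [fourSum] at h4
  linarith

theorem isSymmPosDef_functionalMinus (hw : IsWeight w) : IsSymmPosDef (functionalMinus hw) where
  pos f hf := functionalMinus_pos hw (mul_ne_zero hf hf) fun s t _ _ => by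
    rw [evalAt_mul, evalAt_mul]
    exact ⟨mul_self_nonneg _, mul_self_nonneg _⟩
  symm := functionalMinus_negVars hw

/-- The polynomial `4 (x² - 1) (y² - 1)`, which is `𝒲_{1/2} / 𝒲_{-1/2}`. -/
def discPoly : MvPolynomial (Fin 2) ℝ :=
  MvPolynomial.C 4 * ((MvPolynomial.X 0 ^ 2 - 1) * (MvPolynomial.X 1 ^ 2 - 1))

theorem evalAt_discPoly (z : ℝ × ℝ) :
    evalAt discPoly z = 4 * ((z.1 ^ 2 - 1) * (z.2 ^ 2 - 1)) := by
  simp [evalAt, discPoly]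

theorem totalDegree_discPoly_le : discPoly.totalDegree ≤ 4 := by
  have h : ∀ i : Fin 2, (MvPolynomial.X i ^ 2 - 1 : MvPolynomial (Fin 2) ℝ).totalDegree ≤ 2 :=
    fun i => (MvPolynomial.totalDegree_sub _ _).trans
      (max_le (by rw [MvPolynomial.totalDegree_X_pow]) (by simp))
  refine (MvPolynomial.totalDegree_mul _ _).trans ?_
  rw [MvPolynomial.totalDegree_C, zero_add]
  exact (MvPolynomial.totalDegree_mul _ _).trans (add_le_add (h 0) (h 1))

theorem discPoly_ne_zero : discPoly ≠ 0 := by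
  intro h
  have := evalAt_discPoly (0, 0)
  rw [h] at this
  norm_num [evalAt] at this

theorem fourSum_mul_discPoly (f : MvPolynomial (Fin 2) ℝ) {a b s t : ℝ}
    (h1 : 2 * s * t = a + b) (h2 : s ^ 2 + t ^ 2 = 1 + a * b) :
    fourSum (f * discPoly) s t = (a - b) ^ 2 * fourSum f s t := by
  have e : 4 * ((s ^ 2 - 1) * (t ^ 2 - 1)) = (a - b) ^ 2 := by
    linear_combination (2 * s * t + a + b) * h1 - 4 * h2
  have e' : 4 * ((t ^ 2 - 1) * (s ^ 2 - 1)) = (a - b) ^ 2 := by rw [← e]; ring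
  simp only [fourSum, evalAt_mul, evalAt_discPoly, neg_sq, e, e']
  ring

theorem calW_half {z : ℝ × ℝ} (hz : z ∈ domG) :
    calW w (1 / 2) z = evalAt discPoly z * calW w (-1 / 2) z := by
  have hD : 0 ≤ 4 * ((z.1 ^ 2 - 1) * (z.2 ^ 2 - 1)) := by
    rcases hz with ⟨h1, h2⟩ | ⟨h1, h2⟩ <;> simp only [Set.mem_Iic, Set.mem_Ici] at h1 h2 <;>
      exact mul_nonneg (by norm_num) (mul_nonneg (by nlinarith) (by nlinarith))
  have e : (2 * z.1 * z.2) ^ 2 - 4 * (z.1 ^ 2 + z.2 ^ 2 - 1) =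
      4 * ((z.1 ^ 2 - 1) * (z.2 ^ 2 - 1)) := by ring
  have hpow : |4 * ((z.1 ^ 2 - 1) * (z.2 ^ 2 - 1))| ^ (1 / 2 : ℝ) =
      4 * ((z.1 ^ 2 - 1) * (z.2 ^ 2 - 1)) *
        |4 * ((z.1 ^ 2 - 1) * (z.2 ^ 2 - 1))| ^ (-1 / 2 : ℝ) := by
    generalize 4 * ((z.1 ^ 2 - 1) * (z.2 ^ 2 - 1)) = D at hD
    rw [abs_of_nonneg hD]
    rcases hD.eq_or_lt with rfl | hD
    · rw [Real.zero_rpow (by norm_num), zero_mul]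
    · conv_rhs => rw [← Real.rpow_one_add' hD.le (by norm_num)]
      norm_num
  rw [evalAt_discPoly, calW, calW, weightW, weightW, e, hpow]
  ring

theorem evalAt_mul_calW_half (f : MvPolynomial (Fin 2) ℝ) {z : ℝ × ℝ} (hz : z ∈ domG) :
    evalAt f z * calW w (1 / 2) z = evalAt (f * discPoly) z * calW w (-1 / 2) z := by
  rw [calW_half hz, evalAt_mul, mul_assoc]

theorem measurableSet_domG : MeasurableSet domG :=
  (measurableSet_Iic.prod measurableSet_Iic).union (measurableSet_Ici.prod measurableSet_Ici)

theorem integrableOn_domG_half (hw : IsWeight w) (f : MvPolynomial (Fin 2) ℝ) :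
    IntegrableOn (fun z => evalAt f z * calW w (1 / 2) z) domG :=
  (integrableOn_congr_fun (fun _ hz => evalAt_mul_calW_half f hz) measurableSet_domG).2
    (domG_eq_wedge hw (f * discPoly)).1

/-- The functional `f ↦ c_w² ∫_G f 𝒲_{1/2}`. -/
def functionalPlus (hw : IsWeight w) : MvPolynomial (Fin 2) ℝ →ₗ[ℝ] ℝ :=
  (functionalMinus hw).comp (LinearMap.mulRight ℝ discPoly)

theorem functionalPlus_eq_functionalMinus (hw : IsWeight w) (f : MvPolynomial (Fin 2) ℝ) :
    functionalPlus hw f = functionalMinus hw (f * discPoly) := rfl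

theorem functionalPlus_apply (hw : IsWeight w) (f : MvPolynomial (Fin 2) ℝ) :
    functionalPlus hw f = normConst w ^ 2 * ∫ z in domG, evalAt f z * calW w (1 / 2) z := by
  rw [functionalPlus_eq_functionalMinus, functionalMinus_apply,
    setIntegral_congr_fun measurableSet_domG fun _ hz => evalAt_mul_calW_half f hz]

theorem isSymmPosDef_functionalPlus (hw : IsWeight w) : IsSymmPosDef (functionalPlus hw) where
  pos f hf := by
    refine functionalMinus_pos hw (mul_ne_zero (mul_ne_zero hf hf) discPoly_ne_zero)
      fun s t hs ht => ?_
    have hD : 0 ≤ 4 * ((s ^ 2 - 1) * (t ^ 2 - 1)) :=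
      mul_nonneg (by norm_num) (mul_nonneg (by nlinarith) (by nlinarith))
    simp only [LinearMap.mulRight_apply, evalAt_mul, evalAt_discPoly, neg_sq]
    exact ⟨mul_nonneg (mul_self_nonneg _) hD, mul_nonneg (mul_self_nonneg _) hD⟩
  symm f := by
    have h : negVars discPoly = discPoly := by
      simp [discPoly, negVars]
    conv_lhs => rw [functionalPlus_eq_functionalMinus, ← h, ← map_mul, functionalMinus_negVars]
    rfl

end functionals

/-! ### Minimality of the rules -/

section rules

variable {w : ℝ → ℝ}

/-- Off-diagonal terms occur twice in the full square and diagonal ones once, whence the halving. -/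
theorem sum_sum_eq_two_mul {n : ℕ} (G : Fin n → Fin n → ℝ) (h : ∀ j k, G j k = G k j) :
    ∑ j, ∑ k, G j k = 2 * ∑ k, ∑ j ∈ Finset.Iic k, (if j = k then 1 / 2 else 1) * G j k := by
  have e : ∀ k, ∑ j ∈ Finset.Iic k, (if j = k then 1 / 2 else 1) * G j k =
      ∑ j, if j ≤ k then (if j = k then 1 / 2 else 1) * G j k else 0 := fun k => by
    rw [← Finset.sum_filter]
    congr 1
    ext j
    simp
  simp only [e, two_mul]
  conv_rhs =>
    enter [1]
    rw [Finset.sum_comm]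
  rw [← Finset.sum_add_distrib]
  refine Finset.sum_congr rfl fun j _ => ?_
  rw [← Finset.sum_add_distrib]
  refine Finset.sum_congr rfl fun k _ => ?_
  rcases lt_trichotomy j k with hjk | rfl | hjk
  · simp [hjk.le, hjk.ne, hjk.not_ge]
  · simp; ring
  · simp [hjk.le, hjk.ne, hjk.not_ge, h j k]

theorem functionalMinus_eq_sum (hw : IsWeight w) {n : ℕ} (hn : 1 ≤ n) {x lam : Fin n → ℝ}
    (h : IsGaussRule w n x lam) {f : MvPolynomial (Fin 2) ℝ} (hf : f.totalDegree ≤ 4 * n - 1) :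
    functionalMinus hw f = 1 / 4 * ∑ k, ∑ j ∈ Finset.Iic k,
      (if j = k then 1 / 2 else 1) * (lam j * lam k) *
        fourSum f (sNode x j k) (tNode x j k) := by
  rw [functionalMinus_apply,
    setIntegral_domG_eq_sum hw (d := 2 * n - 1) (by omega) (by omega) h,
    sum_sum_eq_two_mul _ fun j k => by rw [sNode_comm, tNode_comm, mul_comm (lam j)]]
  simp only [mul_assoc]
  ring

theorem functionalPlus_eq_sum (hw : IsWeight w) {n : ℕ} (hn : 2 ≤ n) {x lam : Fin n → ℝ}
    (h : IsGaussRule w n x lam) {f : MvPolynomial (Fin 2) ℝ} (hf : f.totalDegree ≤ 4 * n - 5) :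
    functionalPlus hw f = 1 / 4 * ∑ k, ∑ j ∈ Finset.Iio k, lamPair x lam j k *
        fourSum f (sNode x j k) (tNode x j k) := by
  have hdeg : (f * discPoly).totalDegree ≤ 4 * n - 1 := by
    have := MvPolynomial.totalDegree_mul f discPoly
    have := totalDegree_discPoly_le
    omega
  rw [functionalPlus_eq_functionalMinus, functionalMinus_eq_sum hw (by omega) h hdeg]
  congr 1
  refine Finset.sum_congr rfl fun k _ => ?_
  have e : ∀ j, fourSum (f * discPoly) (sNode x j k) (tNode x j k) =
      (Real.cosh (theta x j) - Real.cosh (theta x k)) ^ 2 *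
        fourSum f (sNode x j k) (tNode x j k) := fun j =>
    fourSum_mul_discPoly f (two_mul_sNode_mul_tNode j k) (sNode_sq_add_tNode_sq j k)
  -- The diagonal term j = k carries the factor (X - Y)² = 0.
  rw [← Finset.Iio_insert, Finset.sum_insert (by simp), e, sub_self]
  simp only [ne_eq, OfNat.ofNat_ne_zero, not_false_eq_true, zero_pow, zero_mul, mul_zero, zero_add]
  refine Finset.sum_congr rfl fun j hj => ?_
  rw [e, if_neg (Finset.mem_Iio.1 hj).ne, lamPair]
  ring

/-- `cubSum` as a linear map in the rule. -/
theorem cubSum_eq_linearCombination (R : ℝ × ℝ →₀ ℝ) (f : MvPolynomial (Fin 2) ℝ) :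
    cubSum R f = Finsupp.linearCombination ℝ (evalAt f) R := by
  simp [cubSum, Finsupp.linearCombination_apply]

theorem linearCombination_fourPoints (f : MvPolynomial (Fin 2) ℝ) (s t : ℝ) :
    Finsupp.linearCombination ℝ (evalAt f) (fourPoints s t) = fourSum f s t := by
  simp [fourPoints, fourSum]

theorem cubSum_ruleMinus {n : ℕ} (x lam : Fin n → ℝ) (f : MvPolynomial (Fin 2) ℝ) :
    cubSum (ruleMinus x lam) f = 1 / 4 * ∑ k, ∑ j ∈ Finset.Iic k,
      (if j = k then 1 / 2 else 1) * (lam j * lam k) *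
        fourSum f (sNode x j k) (tNode x j k) := by
  simp only [cubSum_eq_linearCombination, ruleMinus, map_smul, map_sum,
    linearCombination_fourPoints, smul_eq_mul]

theorem cubSum_rulePlus {n : ℕ} (x lam : Fin n → ℝ) (f : MvPolynomial (Fin 2) ℝ) :
    cubSum (rulePlus x lam) f = 1 / 4 * ∑ k, ∑ j ∈ Finset.Iio k, lamPair x lam j k *
        fourSum f (sNode x j k) (tNode x j k) := by
  simp only [cubSum_eq_linearCombination, rulePlus, map_smul, map_sum,
    linearCombination_fourPoints, smul_eq_mul]

/-! ### Upper bounds for the number of nodes -/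

theorem card_support_sum_le {ι : Type*} (s : Finset ι) (g : ι → ℝ × ℝ →₀ ℝ) :
    (∑ i ∈ s, g i).support.card ≤ ∑ i ∈ s, (g i).support.card := by
  classical
  exact (Finset.card_le_card Finsupp.support_finsetSum).trans Finset.card_biUnion_le

theorem card_support_smul_le (a : ℝ) (g : ℝ × ℝ →₀ ℝ) :
    (a • g).support.card ≤ g.support.card :=
  Finset.card_le_card Finsupp.support_smul

theorem card_support_fourPoints_le (s t : ℝ) : (fourPoints s t).support.card ≤ 4 := by
  have h : ∀ z : ℝ × ℝ, (Finsupp.single z (1 : ℝ)).support.card ≤ 1 := fun z =>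
    Finset.card_le_card Finsupp.support_single_subset
  have hadd : ∀ f g : ℝ × ℝ →₀ ℝ, (f + g).support.card ≤ f.support.card + g.support.card :=
    fun f g => by
      classical
      exact (Finset.card_le_card Finsupp.support_add).trans (Finset.card_union_le _ _)
  refine (hadd _ _).trans (Nat.add_le_add ((hadd _ _).trans (Nat.add_le_add
    ((hadd _ _).trans (Nat.add_le_add (h _) (h _))) (h _))) (h _))

theorem card_support_rule_le {n : ℕ} (S : Fin n → Finset (Fin n)) (a : ℝ)
    (b s t : Fin n → Fin n → ℝ) :
    (a • ∑ k, ∑ j ∈ S k, b j k • fourPoints (s j k) (t j k)).support.card ≤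
      ∑ k, 4 * (S k).card := by
  refine (card_support_smul_le _ _).trans ((card_support_sum_le _ _).trans
    (Finset.sum_le_sum fun k _ => (card_support_sum_le _ _).trans ?_))
  rw [mul_comm, ← smul_eq_mul]
  exact Finset.sum_le_card_nsmul _ _ _ fun j _ =>
    (card_support_smul_le _ _).trans (card_support_fourPoints_le _ _)

theorem card_support_ruleMinus_le {n : ℕ} (x lam : Fin n → ℝ) :
    (ruleMinus x lam).support.card ≤ 2 * n * (n + 1) := by
  refine (card_support_rule_le _ _ _ _ _).trans (le_of_eq ?_)
  simp only [Fin.card_Iic]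
  rw [Fin.sum_univ_eq_sum_range fun k => 4 * (k + 1)]
  induction n with
  | zero => simp
  -- The zero functions are dummies: the identity does not involve `x` and `lam`, but `ih`
  -- quantifies over them.
  | succ n ih => rw [Finset.sum_range_succ, ih (fun _ => 0) fun _ => 0]; ring

theorem card_support_rulePlus_le {n : ℕ} (x lam : Fin n → ℝ) :
    (rulePlus x lam).support.card ≤ 2 * n * (n - 1) := by
  refine (card_support_rule_le _ _ _ _ _).trans (le_of_eq ?_)
  simp only [Fin.card_Iio]
  rw [Fin.sum_univ_eq_sum_range fun k => 4 * k, ← Finset.mul_sum]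
  have := Finset.sum_range_id_mul_two n
  linarith

/-- A rule of degree `2 k + 1`, `k` odd, whose number of nodes does not exceed Möller's bound, is
minimal and attains the bound. -/
theorem isMinimalCubature_of_card_le {W : ℝ × ℝ → ℝ} {c : ℝ}
    {L : MvPolynomial (Fin 2) ℝ →ₗ[ℝ] ℝ} (hL : IsSymmPosDef L)
    (hLW : ∀ f, L f = c * ∫ z in domG, evalAt f z * W z) {k : ℕ} (hk : Even (k + 1))
    {R : ℝ × ℝ →₀ ℝ} (hR : ∀ f, f.totalDegree ≤ 2 * k + 1 → L f = cubSum R f)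
    (hcard : 2 * R.support.card ≤ 2 * dimPi k + (k + 1)) :
    IsMinimalCubature domG (fun z => c * W z) (2 * k + 1) R ∧
      2 * R.support.card = 2 * dimPi k + (k + 1) := by
  have hint : ∀ f, ∫ z in domG, evalAt f z * (c * W z) = L f := fun f => by
    rw [hLW, ← integral_const_mul]
    congr 1
    ext z
    ring
  have bound : ∀ R' : ℝ × ℝ →₀ ℝ, (∀ f, f.totalDegree ≤ 2 * k + 1 → L f = cubSum R' f) →
      2 * dimPi k + (k + 1) ≤ 2 * R'.support.card := fun R' h =>
    two_mul_dimPi_add_le_card hL hk h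
  refine ⟨⟨⟨fun f hf => by rw [hint, hR f hf], fun hex => ?_⟩, fun R' hex => ?_⟩,
    le_antisymm hcard (bound R hR)⟩
  -- Exactness in degree 2k + 2 would require dim Π_{k+1} = dim Π_k + k + 2 nodes, which exceeds dim
  -- Π_k + (k + 1)/2.
  · have := dimPi_le_card hL (m := k + 1) (R := R) fun f hf => by
      rw [← hint]; exact hex f (by omega)
    have h1 := two_mul_dimPi k
    have h2 := two_mul_dimPi (k + 1)
    have h3 : (k + 1 + 1) * (k + 1 + 2) = (k + 1) * (k + 2) + 2 * (k + 2) := by ring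
    omega
  · have := bound R' fun f hf => by rw [← hint]; exact hex f hf
    omega

end rules

end MinCub

end

theorem theorem3p3 (w : ℝ → ℝ) (hw : MinCub.IsWeight w) :
    -- the Gauss nodes and weights exist for every n, the nodes exceed 1, the weights are positive
    (∀ n : ℕ, 1 ≤ n → ∃ x lam : Fin n → ℝ, MinCub.IsGaussRule w n x lam) ∧
    (∀ (n : ℕ) (x lam : Fin n → ℝ), MinCub.IsGaussRule w n x lam →
      ∀ k, 1 < x k ∧ 0 < lam k) ∧
    -- the integrals converge
    (∀ f : MvPolynomial (Fin 2) ℝ,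
      IntegrableOn (fun z => MinCub.evalAt f z * MinCub.calW w (-1 / 2) z) MinCub.domG ∧
      IntegrableOn (fun z => MinCub.evalAt f z * MinCub.calW w (1 / 2) z) MinCub.domG) ∧
    -- the rule for the exponent -1/2
    (∀ n : ℕ, 1 ≤ n → ∀ x lam : Fin n → ℝ, MinCub.IsGaussRule w n x lam →
      (∀ f : MvPolynomial (Fin 2) ℝ, f.totalDegree ≤ 4 * n - 1 →
        MinCub.normConst w ^ 2 *
            ∫ z in MinCub.domG, MinCub.evalAt f z * MinCub.calW w (-1 / 2) z =
          1 / 4 * ∑ k, ∑ j ∈ Finset.Iic k, (if j = k then 1 / 2 else 1) * (lam j * lam k) *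
            MinCub.fourSum f (MinCub.sNode x j k) (MinCub.tNode x j k)) ∧
      MinCub.IsMinimalCubature MinCub.domG
        (fun z => MinCub.normConst w ^ 2 * MinCub.calW w (-1 / 2) z) (4 * n - 1)
        (MinCub.ruleMinus x lam) ∧
      (MinCub.ruleMinus x lam).support.card = MinCub.dimPi (2 * n - 1) + n ∧
      (MinCub.ruleMinus x lam).support.card = MinCub.mollerNumber (2 * n)) ∧
    -- the rule for the exponent 1/2
    (∀ n : ℕ, 2 ≤ n → ∀ x lam : Fin n → ℝ, MinCub.IsGaussRule w n x lam →
      (∀ f : MvPolynomial (Fin 2) ℝ, f.totalDegree ≤ 4 * n - 5 →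
        MinCub.normConst w ^ 2 *
            ∫ z in MinCub.domG, MinCub.evalAt f z * MinCub.calW w (1 / 2) z =
          1 / 4 * ∑ k, ∑ j ∈ Finset.Iio k, MinCub.lamPair x lam j k *
            MinCub.fourSum f (MinCub.sNode x j k) (MinCub.tNode x j k)) ∧
      MinCub.IsMinimalCubature MinCub.domG
        (fun z => MinCub.normConst w ^ 2 * MinCub.calW w (1 / 2) z) (4 * n - 5)
        (MinCub.rulePlus x lam) ∧
      (MinCub.rulePlus x lam).support.card = MinCub.dimPi (2 * n - 3) + (n - 1) ∧
      (MinCub.rulePlus x lam).support.card = MinCub.mollerNumber (2 * n - 2)) := by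
  refine ⟨fun n _ => MinCub.exists_isGaussRule hw n, fun n x lam h => h.one_lt_and_pos hw,
    fun f => ⟨(MinCub.domG_eq_wedge hw f).1, MinCub.integrableOn_domG_half hw f⟩, ?_, ?_⟩
  · intro n hn x lam h
    have hR : ∀ f : MvPolynomial (Fin 2) ℝ, f.totalDegree ≤ 4 * n - 1 →
        MinCub.functionalMinus hw f = MinCub.cubSum (MinCub.ruleMinus x lam) f := fun f hf => by
      rw [MinCub.functionalMinus_eq_sum hw hn h hf, MinCub.cubSum_ruleMinus]
    have e : 4 * n - 1 = 2 * (2 * n - 1) + 1 := by omega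
    -- The crude count of four nodes per pair j ≤ k is exactly Möller's number for the odd value k =
    -- 2n - 1.
    have hcount : 2 * (2 * n * (n + 1)) = 2 * MinCub.dimPi (2 * n - 1) + (2 * n - 1 + 1) := by
      obtain ⟨r, rfl⟩ := Nat.exists_eq_add_of_le' hn
      rw [MinCub.two_mul_dimPi, show 2 * (r + 1) - 1 = 2 * r + 1 by omega]
      ring
    have hle := MinCub.card_support_ruleMinus_le x lam
    obtain ⟨hmin, hcard⟩ := MinCub.isMinimalCubature_of_card_le
      (MinCub.isSymmPosDef_functionalMinus hw) (MinCub.functionalMinus_apply hw)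
      (k := 2 * n - 1) ⟨n, by omega⟩ (e ▸ hR) (by omega)
    refine ⟨fun f hf => MinCub.functionalMinus_eq_sum hw hn h hf, e ▸ hmin, by omega, ?_⟩
    rw [MinCub.mollerNumber]
    omega
  · intro n hn x lam h
    have hR : ∀ f : MvPolynomial (Fin 2) ℝ, f.totalDegree ≤ 4 * n - 5 →
        MinCub.functionalPlus hw f = MinCub.cubSum (MinCub.rulePlus x lam) f := fun f hf => by
      rw [MinCub.functionalPlus_eq_sum hw hn h hf, MinCub.cubSum_rulePlus]
    have e : 4 * n - 5 = 2 * (2 * n - 3) + 1 := by omega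
    -- The same coincidence for pairs j < k, now with k = 2n - 3.
    have hcount : 2 * (2 * n * (n - 1)) = 2 * MinCub.dimPi (2 * n - 3) + (2 * n - 3 + 1) := by
      obtain ⟨r, rfl⟩ := Nat.exists_eq_add_of_le' hn
      rw [MinCub.two_mul_dimPi, show 2 * (r + 2) - 3 = 2 * r + 1 by omega,
        show r + 2 - 1 = r + 1 by omega]
      ring
    have hle := MinCub.card_support_rulePlus_le x lam
    obtain ⟨hmin, hcard⟩ := MinCub.isMinimalCubature_of_card_le
      (MinCub.isSymmPosDef_functionalPlus hw) (MinCub.functionalPlus_apply hw)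
      (k := 2 * n - 3) ⟨n - 1, by omega⟩ (e ▸ hR) (by omega)
    refine ⟨fun f hf => ?_, e ▸ hmin, by omega, ?_⟩
    · rw [← MinCub.functionalPlus_apply hw, MinCub.functionalPlus_eq_sum hw hn h hf]
    · rw [MinCub.mollerNumber, show 2 * n - 2 - 1 = 2 * n - 3 by omega]
      omega
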